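/- Let $K\subset\mathbb C$ be an imaginary quadratic field (with a fixed complex embedding) of class number one, with ring of integers $\mathscr O$, finite adèles $\mathbb A_f$ and $\widehat{\mathscr O}=\prod_v\mathscr O_v$. Let $\phi_1,\phi_2$ be Hecke characters of the idèles $\mathbb C^\times\times\mathbb A_f^\times$ of $K$ with $\phi_{1,\infty}(z)=z$ and $\phi_{2,\infty}(z)=z^{-1}$, such that $\chi=\phi_1/\phi_2$ (which has $\chi_\infty(z)=z^2$) is unramified. Put $G(\mathbb Q)=\operatorname{GL}_2(K)$, $G(\mathbb A)=\operatorname{GL}_2(\mathbb C)\times\operatorname{GL}_2(\mathbb A_f)$, let $B$ be the upper triangular subgroup, $K_\infty=\mathbb C^\times\operatorname U(2)$, and let $K_f$ be the group of $k\in\operatorname{GL}_2(\widehat{\mathscr O})$ with $\det k\equiv1$ modulo the conductor of $\phi_1$. For $s\in\mathbb C$ let $V_{\phi_s}$ be the space of functions $\Psi$ on $\operatorname{GL}_2(\mathbb A_f)$, right invariant under $K_f$, with $\Psi\left(\begin{pmatrix}a&x\\0&d\end{pmatrix}g\right)=\phi_1(a)\phi_2(d)\,|a/d|^{s/2}\,\Psi(g)$,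 where $|\cdot|$ is the normalized absolute value of the finite idèles; $V_\phi=V_{\phi_0}$. Let $\mathfrak p$ be the space of traceless Hermitian $2\times2$ matrices, identified with the tangent space at $j$ of $\mathbb H_3=\{z+jv : z\in\mathbb C,\ v>0\}$ by $X\mapsto\frac{d}{dt}\big|_{t=0}\exp(tX)j$, and let $\check S(X)$ be the upper right entry of $X\in\mathfrak p$. For $\Psi\in V_{\phi_s}$, $X\in\mathfrak p$ and $g=(g_\infty,g_f)\in G(\mathbb A)$ with $g_\infty=\begin{pmatrix}a&x\\0&d\end{pmatrix}k_\infty$, $a,d>0$, $k_\infty\in K_\infty$, put $$\widetilde\omega_{\Psi,s}[X](g)=\left|\tfrac ad\right|^{1+s}\Psi(g_f)\,\check S(\operatorname{Ad}(k_\infty)X),\qquad \operatorname{Eis}(\Psi,s)[X](g)=\sum_{\gamma\in B(\mathbb Q)\backslash G(\mathbb Q)}\widetilde\omega_{\Psi,s}[X](\gamma g).$$ Let $\Gamma=\operatorname{SL}_2(\mathscr O)$, let $\Gamma_\infty=\Gamma\cap B(\mathbb Q)$ be the stabilizer of the cusp $\infty$, let $N_\infty\subset\Gamma_\infty$ be the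 subgroup of the unipotent matrices $\begin{pmatrix}1&b\\0&1\end{pmatrix}$, $b\in\mathscr O$, and let $$E_\chi(u,s)=\sum_{\gamma\in\Gamma_\infty\backslash\Gamma}\gamma^*(v^s\,dz).$$ **Proposition.** The form $v^s\,dz$ is $\Gamma_\infty$-invariant, and $\widetilde\omega_{\Psi,s}$ is left $B(\mathbb Q)$-invariant, right $K_f$-invariant and satisfies $\widetilde\omega_{\Psi,s}[X](gk)=\widetilde\omega_{\Psi,s}[\operatorname{Ad}(k)X](g)$ for $k\in K_\infty$. For $\operatorname{Re}(s)>1$ the series $\operatorname{Eis}(\Psi,s)$ and $E_\chi(u,s)$ converge absolutely, and for every $\Psi\in V_{\phi_s}$ the 1-form on $\mathbb H_3$ corresponding to $\operatorname{Eis}(\Psi,s)$ is $\tfrac12\Psi(1)E_\chi(u,s)$: for all $g\in\operatorname{GL}_2(\mathbb C)$, $u=gj$ and $\xi\in T_u\mathbb H_3$, $$\operatorname{Eis}(\Psi,s)\big[d_uL_{g^{-1}}\xi\big](g,1)=\tfrac12\,\Psi(1)\,E_\chi(u,s)(\xi)=\tfrac14\,\Psi(1)\sum_{\gamma\in N_\infty\backslash\Gamma}\big(\gamma^*(v^s\,dz)\big)_u(\xi),$$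 the last series being absolutely convergent too. More generally, for $\gamma\in\operatorname{GL}_2(K)$ and $k\in\operatorname{GL}_2(\widehat{\mathscr O})$ the value of $\operatorname{Eis}(\Psi,s)[d_uL_{g^{-1}}\xi]$ at $\gamma\cdot(g,k)$ is given by the same formulas with $\Psi(1)$ replaced by $\Psi(k)$. In particular $\operatorname{Eis}(\Psi,s)=\tfrac12E_\chi(u,s)$ when $\Psi(1)=1$. Moreover, let $\Psi\in V_\phi$. For every $s$, the function given by $\Psi_s(bk)=|a/d|^{s/2}\,\Psi(bk)$ for $b=\begin{pmatrix}a&x\\0&d\end{pmatrix}\in B(\mathbb A_f)$ and $k\in\operatorname{GL}_2(\widehat{\mathscr O})$ belongs to $V_{\phi_s}$ and agrees with $\Psi$ on $\operatorname{GL}_2(\widehat{\mathscr O})$, and the identity $\operatorname{Eis}(\Psi_s,s)=\tfrac12\Psi(1)E_\chi(u,s)$ (and its version at $\gamma\cdot(g,k)$, with $\Psi(k)$) persists under analytic continuation: if, for fixed $u,g,\xi,\gamma,k$, the two sides have analytic continuations in $s$ to a connected open set $U\subset\mathbb C$ that meets $\{\operatorname{Re}(s)>1\}$, then these agree on $U$.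 -/

import Mathlib

open scoped NumberField Matrix ComplexConjugate
open IsDedekindDomain

noncomputable section

namespace Bianchi

/-! ## Hyperbolic three-space -/

/-- The action of an invertible complex matrix on hyperbolic 3-space, a point `z + j v` (`0 < v`)
being written as the pair `(z, v)`.  For determinant one this is `u ↦ (a u + b) (c u + d)⁻¹`
computed in the quaternions; scalar matrices act trivially. -/
def act (g : Matrix (Fin 2) (Fin 2) ℂ) (u : ℂ × ℝ) : ℂ × ℝ :=
  (((g 0 0 * u.1 + g 0 1) * conj (g 1 0 * u.1 + g 1 1) + g 0 0 * conj (g 1 0) * (u.2 : ℂ) ^ 2) /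
      ((‖g 1 0 * u.1 + g 1 1‖ ^ 2 + ‖g 1 0‖ ^ 2 * u.2 ^ 2 : ℝ) : ℂ),
    ‖g.det‖ * u.2 / (‖g 1 0 * u.1 + g 1 1‖ ^ 2 + ‖g 1 0‖ ^ 2 * u.2 ^ 2))

/-- The base point `j`. -/
def basePt : ℂ × ℝ := (0, 1)

/-- The complex 1-form `v ^ s dz`. -/
def vsdz (s : ℂ) (u : ℂ × ℝ) : ℂ × ℝ →L[ℝ] ℂ :=
  ((u.2 : ℂ) ^ s) • ContinuousLinearMap.fst ℝ ℂ ℝ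

/-- Pull-back of a 1-form under the action of a matrix. -/
def pullback (g : Matrix (Fin 2) (Fin 2) ℂ) (ω : ℂ × ℝ → (ℂ × ℝ →L[ℝ] ℂ)) (u : ℂ × ℝ) :
    ℂ × ℝ →L[ℝ] ℂ :=
  (ω (act g u)).comp (fderiv ℝ (act g) u)

/-! ## The classical Eisenstein series -/

section Classical

variable {K : Type*} [Field K] [NumberField K] (σ : K →+* ℂ)

/-- An element of `SL₂(𝓞)` as a complex matrix, through the fixed embedding `σ`. -/
def slMatrix (γ : Matrix.SpecialLinearGroup (Fin 2) (𝓞 K)) : Matrix (Fin 2) (Fin 2) ℂ :=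
  (γ : Matrix (Fin 2) (Fin 2) (𝓞 K)).map fun x => σ (x : K)

variable (K) in
/-- The stabilizer of the cusp `∞` in `Γ = SL₂(𝓞)`, that is `Γ ∩ B(K)`. -/
def stabInfty : Subgroup (Matrix.SpecialLinearGroup (Fin 2) (𝓞 K)) where
  carrier := {γ | γ 1 0 = 0}
  one_mem' := by simp
  mul_mem' := by
    intro a b ha hb
    simp only [Set.mem_ofPred_eq] at ha hb ⊢
    simp [Matrix.mul_apply, Fin.sum_univ_two, ha, hb]
  inv_mem' := by
    intro a ha
    simp only [Set.mem_ofPred_eq] at ha ⊢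
    simp [Matrix.SpecialLinearGroup.SL2_inv_expl, ha]

variable (K) in
/-- The unipotent radical of the stabilizer of `∞`: the matrices `(1 b; 0 1)` with `b ∈ 𝓞`. -/
def unipInfty : Subgroup (Matrix.SpecialLinearGroup (Fin 2) (𝓞 K)) where
  carrier := {γ | γ 0 0 = 1 ∧ γ 1 0 = 0 ∧ γ 1 1 = 1}
  one_mem' := by simp
  mul_mem' := by
    rintro a b ⟨h1, h2, h3⟩ ⟨h4, h5, h6⟩
    simp [Matrix.mul_apply, Fin.sum_univ_two, h1, h2, h3, h4, h5, h6]
  inv_mem' := by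
    rintro a ⟨h1, h2, h3⟩
    simp only [Set.mem_ofPred_eq]
    simp [Matrix.SpecialLinearGroup.SL2_inv_expl, h1, h2, h3]

/-- The term `γ^* (v ^ s dz)` at `u` of the Eisenstein series over `P \ Γ`, on a class `P γ`
(`QuotientGroup.rightRel P` is the relation with classes `P γ`). -/
def classicalTerm (P : Subgroup (Matrix.SpecialLinearGroup (Fin 2) (𝓞 K))) (s : ℂ) (u : ℂ × ℝ)
    (q : Quotient (QuotientGroup.rightRel P)) : ℂ × ℝ →L[ℝ] ℂ :=
  pullback (slMatrix σ q.out) (vsdz s) u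

/-- The Eisenstein series `∑_{γ ∈ P \ Γ} γ^* (v ^ s dz)`, a 1-form. -/
def classicalEis (P : Subgroup (Matrix.SpecialLinearGroup (Fin 2) (𝓞 K))) (s : ℂ) (u : ℂ × ℝ) :
    ℂ × ℝ →L[ℝ] ℂ :=
  ∑' q, classicalTerm σ P s u q

end Classical

/-! ## Idèles and Hecke characters -/

section Adelic

variable (K : Type*) [Field K] [NumberField K]

/-- The finite adèles of `K`. -/
abbrev Af := FiniteAdeleRing (𝓞 K) K

/-- The idèles of an imaginary quadratic field, `K ⊗ ℝ` being identified with `ℂ` through the fixed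
embedding. -/
abbrev Ideles := ℂˣ × (Af K)ˣ

variable {K}

/-- The diagonal embedding of `Kˣ` into the idèles. -/
def principal (σ : K →+* ℂ) : Kˣ →* Ideles K :=
  (Units.map (σ : K →* ℂ)).prod (Units.map (algebraMap K (Af K) : K →* Af K))

/-- Hecke (quasi-)characters: continuous characters of the idèles, trivial on `Kˣ`. -/
structure HeckeCharacter (σ : K →+* ℂ) where
  toHom : Ideles K →ₜ* ℂˣ
  map_principal : ∀ x : Kˣ, toHom (principal σ x) = 1

namespace HeckeCharacter

variable {σ : K →+* ℂ}

/-- The archimedean component. -/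
def infPart (φ : HeckeCharacter σ) (z : ℂˣ) : ℂ := (φ.toHom (z, 1) : ℂ)

/-- The restriction to the finite idèles. -/
def finPart (φ : HeckeCharacter σ) (x : (Af K)ˣ) : ℂ := (φ.toHom (1, x) : ℂ)

/-- `φ` is unramified: trivial on `∏_v 𝓞_v^×`. -/
def IsUnramified (φ : HeckeCharacter σ) : Prop :=
  ∀ x : (Af K)ˣ, (∀ v, Valued.v ((x : Af K) v) = 1) → φ.finPart x = 1

/-- The exponent at `v` of the conductor: the least `n` such that `φ` is trivial on the local units
at `v` that are congruent to `1` modulo the `n`-th power of the maximal ideal. -/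
def condExp (φ : HeckeCharacter σ) (v : HeightOneSpectrum (𝓞 K)) : ℕ :=
  sInf {n : ℕ | ∀ x : (Af K)ˣ, (∀ w, w ≠ v → (x : Af K) w = 1) →
    Valued.v ((x : Af K) v) = 1 →
    Valued.v ((x : Af K) v - 1) ≤ WithZero.exp (-(n : ℤ)) → φ.finPart x = 1}

end HeckeCharacter

/-- The normalized absolute value on the finite idèles (and on the finite adèles). -/
def finNorm (x : Af K) : ℝ := ∏ᶠ v : HeightOneSpectrum (𝓞 K), ‖x v‖

/-! ## The group `GL₂` over the adèles -/

/-- The matrix `(a x; 0 d)`. -/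
def upper {R : Type*} [CommRing R] (a d : Rˣ) (x : R) : GL (Fin 2) R :=
  Matrix.GeneralLinearGroup.mk'' !![(a : R), x; 0, (d : R)] (by
    rw [Matrix.det_fin_two_of, mul_zero, sub_zero]
    exact (a * d).isUnit)

variable (K) in
/-- `G(𝔸) = GL₂(ℂ) × GL₂(𝔸_f)`, with elements `g = (g_∞, g_f)`. -/
abbrev GA := GL (Fin 2) ℂ × GL (Fin 2) (Af K)

/-- The diagonal embedding of `G(ℚ) = GL₂(K)` into `G(𝔸)`. -/
def rational (σ : K →+* ℂ) : GL (Fin 2) K →* GA K :=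
  (Matrix.GeneralLinearGroup.map σ).prod (Matrix.GeneralLinearGroup.map (algebraMap K (Af K)))

variable (K) in
/-- `B(ℚ)`, the upper triangular matrices in `GL₂(K)`. -/
def borel : Subgroup (GL (Fin 2) K) where
  carrier := {γ | γ 1 0 = 0}
  one_mem' := by simp
  mul_mem' := by
    intro a b ha hb
    simp only [Set.mem_ofPred_eq] at ha hb ⊢
    simp [Matrix.mul_apply, Fin.sum_univ_two, ha, hb]
  inv_mem' := by
    intro a ha
    simp only [Set.mem_ofPred_eq] at ha ⊢
    simp [Matrix.inv_def, Matrix.adjugate_fin_two, ha]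

variable (K) in
/-- `∏_v GL₂(𝓞_v)`. -/
def maxCompact : Set (GL (Fin 2) (Af K)) :=
  {k | ∀ v, (∀ i j, Valued.v ((k i j) v) ≤ 1) ∧
    Valued.v ((k : Matrix (Fin 2) (Fin 2) (Af K)).det v) = 1}

/-- The level group `K_f`: the `k` in `∏_v GL₂(𝓞_v)` with `det k ≡ 1` modulo the conductor of `φ`
(no condition at the places that do not divide the conductor). -/
def level {σ : K →+* ℂ} (φ : HeckeCharacter σ) : Set (GL (Fin 2) (Af K)) :=
  {k | k ∈ maxCompact K ∧ ∀ v, Valued.v ((k : Matrix (Fin 2) (Fin 2) (Af K)).det v - 1) ≤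
    WithZero.exp (-(φ.condExp v : ℤ))}

/-- `K_∞ = ℂ^* · U(2)`. -/
def Kinf : Set (GL (Fin 2) ℂ) :=
  {k | ∃ c : ℂ, c ≠ 0 ∧ ∃ w ∈ Matrix.unitaryGroup (Fin 2) ℂ,
    (k : Matrix (Fin 2) (Fin 2) ℂ) = c • w}

/-- The induced space `V_{φ_s}`: functions on `G(𝔸_f)` with `Ψ (b g) = φ_s(b) Ψ(g)` for upper
triangular `b`, where `φ_s (a x; 0 d) = φ₁(a) φ₂(d) |a/d|^{s/2}`, right invariant under `K_f`.
The space `V_φ` is the case `s = 0`. -/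
def inducedSpace {σ : K →+* ℂ} (φ₁ φ₂ : HeckeCharacter σ) (s : ℂ) :
    Submodule ℂ (GL (Fin 2) (Af K) → ℂ) where
  carrier := {Ψ | (∀ (a d : (Af K)ˣ) (x : Af K) (g : GL (Fin 2) (Af K)),
      Ψ (upper a d x * g) =
        φ₁.finPart a * φ₂.finPart d * (finNorm ((a / d : (Af K)ˣ) : Af K) : ℂ) ^ (s / 2) * Ψ g) ∧
    ∀ g, ∀ k ∈ level φ₁, Ψ (g * k) = Ψ g}
  zero_mem' := by simp
  add_mem' := by
    rintro Ψ Ψ' ⟨h1, h2⟩ ⟨h1', h2'⟩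
    refine ⟨fun a d x g => ?_, fun g k hk => ?_⟩
    · simp only [Pi.add_apply, h1, h1', mul_add]
    · simp only [Pi.add_apply, h2 g k hk, h2' g k hk]
  smul_mem' := by
    rintro c Ψ ⟨h1, h2⟩
    refine ⟨fun a d x g => ?_, fun g k hk => ?_⟩
    · simp only [Pi.smul_apply, smul_eq_mul, h1]; ring
    · simp only [Pi.smul_apply, h2 g k hk]

/-- The height `|a/d|` of `g = (a x; 0 d) k`, `k ∈ ∏_v GL₂(𝓞_v)`: at each place, the bottom row of
`g` is `d` times a unimodular row. -/
def finHeight (g : GL (Fin 2) (Af K)) : ℝ :=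
  finNorm (g : Matrix (Fin 2) (Fin 2) (Af K)).det /
    (∏ᶠ v : HeightOneSpectrum (𝓞 K), max ‖(g 1 0) v‖ ‖(g 1 1) v‖) ^ 2

/-- The flat section through `Ψ ∈ V_φ`: the element of `V_{φ_s}` that has the same restriction to
`∏_v GL₂(𝓞_v)`. -/
def flatSection (Ψ : GL (Fin 2) (Af K) → ℂ) (s : ℂ) (g : GL (Fin 2) (Af K)) : ℂ :=
  Ψ g * (finHeight g : ℂ) ^ (s / 2)

end Adelic

/-! ## The Lie algebra part -/

/-- `𝔭`: the traceless Hermitian matrices, the complement of `Lie K_∞` in `Lie G(ℝ)`. -/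
def 𝔭 : Submodule ℝ (Matrix (Fin 2) (Fin 2) ℂ) where
  carrier := {X | X.IsHermitian ∧ X.trace = 0}
  zero_mem' := by simp
  add_mem' := by
    rintro X Y ⟨h1, h2⟩ ⟨h3, h4⟩
    exact ⟨h1.add h3, by simp [h2, h4]⟩
  smul_mem' := by
    rintro c X ⟨h1, h2⟩
    refine ⟨?_, by simp [h2]⟩
    unfold Matrix.IsHermitian at *
    rw [Matrix.conjTranspose_smul, h1]
    simp

/-- The functional `Š` on `𝔭`: the member of the dual basis belonging to `S` in the basis
`S = (X ⊗ 1 - Y ⊗ i) / 2`, `(X ⊗ 1 + Y ⊗ i) / 2`, `diag(1, -1)` of `𝔭 ⊗ ℂ`, where `X = (0 1; 1 0)`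
and `Y = (0 i; -i 0)`; see `Scheck_basis`. -/
def Scheck : Matrix (Fin 2) (Fin 2) ℂ →ₗ[ℝ] ℂ where
  toFun M := M 0 1
  map_add' _ _ := rfl
  map_smul' _ _ := rfl

theorem Scheck_basis :
    (1 / 2 : ℂ) * (Scheck !![0, 1; 1, 0] - Scheck !![0, Complex.I; -Complex.I, 0] * Complex.I) = 1 ∧
    (1 / 2 : ℂ) * (Scheck !![0, 1; 1, 0] + Scheck !![0, Complex.I; -Complex.I, 0] * Complex.I) = 0 ∧
    Scheck !![1, 0; 0, -1] = 0 := by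
  have h : ∀ M, Scheck M = M 0 1 := fun _ => rfl
  refine ⟨?_, ?_, ?_⟩
  · simp [h]
    norm_num
  · simp [h]
  · simp [h]

/-- The identification of `𝔭` with the tangent space at `j`, sending `M` to the velocity at `t = 0`
of `exp (t M) j`: `X ↦ 2 ∂/∂x`, `Y ↦ 2 ∂/∂y`, `diag(1, -1) ↦ 2 ∂/∂v`;
see `tangentEquiv_hasDerivAt`. -/
def tangentEquiv : 𝔭 ≃ₗ[ℝ] ℂ × ℝ where
  toFun M := (2 * M.1 0 1, 2 * (M.1 0 0).re)
  map_add' M N := by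
    ext <;> simp <;> ring
  map_smul' c M := by
    ext <;> simp <;> ring
  invFun ξ := ⟨!![(ξ.2 / 2 : ℝ), ξ.1 / 2; conj ξ.1 / 2, -((ξ.2 / 2 : ℝ) : ℂ)], by
    constructor
    · ext i j
      fin_cases i <;> fin_cases j <;> simp
    · simp [Matrix.trace_fin_two]⟩
  left_inv := by
    rintro ⟨M, hM, hT⟩
    rw [Matrix.trace_fin_two] at hT
    have h00 := hM.apply 0 0
    have h10 := hM.apply 1 0
    ext i j
    have hre : ((M 0 0).re : ℂ) = M 0 0 := Complex.conj_eq_iff_re.mp h00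
    fin_cases i <;> fin_cases j
    · simp [hre]
    · simp
    · simpa [map_ofNat] using h10
    · simp only [Fin.mk_one, Matrix.of_apply, Matrix.cons_val]
      simp [hre]
      linear_combination -hT
  right_inv := by
    intro ξ
    ext <;> simp <;> ring

/-- A decomposition `g = (a x; 0 d) k` with positive real `a`, `d` and `k ∈ K_∞`. -/
def IsIwasawa (g : GL (Fin 2) ℂ) (a d : ℝ) (x : ℂ) (k : GL (Fin 2) ℂ) : Prop :=
  0 < a ∧ 0 < d ∧ k ∈ Kinf ∧
    (g : Matrix (Fin 2) (Fin 2) ℂ) = !![(a : ℂ), x; 0, (d : ℂ)] * (k : Matrix (Fin 2) (Fin 2) ℂ)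

theorem tangentEquiv_hasDerivAt (M : 𝔭) :
    HasDerivAt (fun t : ℝ => act (NormedSpace.exp (t • (M : Matrix (Fin 2) (Fin 2) ℂ))) basePt)
      (tangentEquiv M) 0 := by
  obtain ⟨M, hM, hT⟩ := M
  rw [Matrix.trace_fin_two] at hT
  have h00 : conj (M 0 0) = M 0 0 := hM.apply 0 0
  have h10 : conj (M 1 0) = M 0 1 := hM.apply 0 1
  have hre : ((M 0 0).re : ℂ) = M 0 0 := Complex.conj_eq_iff_re.mp h00
  have h11 : M 1 1 = -M 0 0 := by linear_combination hT
  let _ : NormedRing (Matrix (Fin 2) (Fin 2) ℂ) := Matrix.linftyOpNormedRing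
  let _ : NormedAlgebra ℝ (Matrix (Fin 2) (Fin 2) ℂ) := Matrix.linftyOpNormedAlgebra
  have hexp := hasDerivAt_exp_smul_const (𝕂 := ℝ) M (0 : ℝ)
  simp only [zero_smul, NormedSpace.exp_zero, one_mul] at hexp
  have hent : ∀ i j, HasDerivAt (fun t : ℝ => NormedSpace.exp (t • M) i j) (M i j) 0 := by
    intro i j
    have := hasDerivAt_pi.1 (hasDerivAt_pi.1 hexp i) j
    exact this
  generalize hm : (fun t : ℝ => NormedSpace.exp (t • M)) = m at hent
  have hm' : ∀ t, NormedSpace.exp (t • M) = m t := fun t => by rw [← hm]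
  have hm0 : m 0 = 1 := by rw [← hm']; simp
  simp only [hm'] at hent ⊢
  have hden := ((hent 1 1).norm_sq).add ((hent 1 0).norm_sq)
  have hdet := ((((hent 0 0).mul (hent 1 1)).sub ((hent 0 1).mul (hent 1 0))).norm_sq).sqrt
    (by simp [hm0])
  have hc11 := (hent 1 1).star
  have hc10 := (hent 1 0).star
  have hnum := ((hent 0 1).mul hc11).add ((hent 0 0).mul hc10)
  have h1 := hnum.div hden.ofReal_comp (by simp [hm0])
  have h2 := hdet.div hden (by simp [hm0])
  have h3 := h1.prodMk h2
  convert h3 using 1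
  · ext t
    · simp [act, basePt]
    · simp [act, basePt, Matrix.det_fin_two]
  · ext
    · simp [tangentEquiv, hm0, h10]
      ring
    · simp [tangentEquiv, hm0, h11]

theorem exists_isIwasawa (g : GL (Fin 2) ℂ) : ∃ a d x k, IsIwasawa g a d x k := by
  have hdet : (g : Matrix (Fin 2) (Fin 2) ℂ).det ≠ 0 := g.det.ne_zero
  obtain ⟨p, q, r, t, hg⟩ : ∃ p q r t : ℂ, (g : Matrix (Fin 2) (Fin 2) ℂ) = !![p, q; r, t] :=
    ⟨_, _, _, _, Matrix.eta_fin_two _⟩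
  rw [hg, Matrix.det_fin_two_of] at hdet
  set δ := p * t - q * r with hδ
  have hN : 0 < ‖r‖ ^ 2 + ‖t‖ ^ 2 := by
    rcases eq_or_ne r 0 with h | h
    · have : t ≠ 0 := by
        rintro rfl
        exact hdet (by simp [hδ, h])
      positivity
    · positivity
  set n := √(‖r‖ ^ 2 + ‖t‖ ^ 2) with hn
  have hn0 : 0 < n := Real.sqrt_pos.2 hN
  have hn2 : (n : ℂ) ^ 2 = r * conj r + t * conj t := by
    rw [Complex.mul_conj', Complex.mul_conj', ← Complex.ofReal_pow, hn, Real.sq_sqrt hN.le]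
    push_cast
    rfl
  have hnC : (n : ℂ) ≠ 0 := by exact_mod_cast hn0.ne'
  have hδ0 : (‖δ‖ : ℂ) ≠ 0 := by simpa using hdet
  have hδ2 : δ * conj δ = (‖δ‖ : ℂ) ^ 2 := Complex.mul_conj' δ
  set W : Matrix (Fin 2) (Fin 2) ℂ :=
    !![δ / ‖δ‖ * conj t / n, -(δ / ‖δ‖ * conj r / n); r / n, t / n] with hW
  have hWdet : W.det ≠ 0 := by
    have : W.det = δ / ‖δ‖ := by
      rw [hW, Matrix.det_fin_two_of]
      field_simp
      linear_combination -hn2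
    rw [this]
    exact div_ne_zero hdet hδ0
  refine ⟨‖δ‖ / n, n, (p * conj r + q * conj t) / n,
    Matrix.GeneralLinearGroup.mkOfDetNeZero W hWdet, by positivity, hn0,
    ⟨1, one_ne_zero, W, ?_, ?_⟩, ?_⟩
  · rw [Matrix.mem_unitaryGroup_iff]
    ext i j
    fin_cases i <;> fin_cases j <;>
      simp [hW, Matrix.mul_apply, Fin.sum_univ_two, Matrix.star_apply]
    · field_simp
      linear_combination (t * conj t + r * conj r) * hδ2 - (‖δ‖ : ℂ) ^ 2 * hn2
    · field_simp
      ring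
    · field_simp
      ring
    · field_simp
      linear_combination -hn2
  · rw [one_smul]
    rfl
  · change _ = _ * W
    rw [hg, hW]
    ext i j
    fin_cases i <;> fin_cases j <;> simp [Matrix.mul_apply, Fin.sum_univ_two]
    · field_simp
      linear_combination p * hn2 - conj t * hδ
    · field_simp
      linear_combination q * hn2 + conj r * hδ
    · field_simp
    · field_simp

/-- Only the scalar part of an Iwasawa decomposition is ambiguous: `a / d` and `Ad(k)` are
well defined. -/
theorem IsIwasawa.unique {g k k' : GL (Fin 2) ℂ} {a d a' d' : ℝ} {x x' : ℂ}
    (h : IsIwasawa g a d x k) (h' : IsIwasawa g a' d' x' k') (X : Matrix (Fin 2) (Fin 2) ℂ) :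
    a / d = a' / d' ∧ (k : Matrix (Fin 2) (Fin 2) ℂ) * X * (k⁻¹ : GL (Fin 2) ℂ) =
      (k' : Matrix (Fin 2) (Fin 2) ℂ) * X * (k'⁻¹ : GL (Fin 2) ℂ) := by
  obtain ⟨ha, hd, ⟨c, hc, w, hw, hk⟩, hg⟩ := h
  obtain ⟨ha', hd', ⟨c', hc', w', hw', hk'⟩, hg'⟩ := h'
  have key : ∀ (a d : ℝ) (x c : ℂ) (w : Matrix (Fin 2) (Fin 2) ℂ),
      w ∈ Matrix.unitaryGroup (Fin 2) ℂ →
      (!![(a : ℂ), x; 0, (d : ℂ)] * c • w) * star (!![(a : ℂ), x; 0, (d : ℂ)] * c • w) =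
      ((‖c‖ : ℂ) ^ 2) • !![(a : ℂ) ^ 2 + x * conj x, x * d; d * conj x, (d : ℂ) ^ 2] := by
    intro a d x c w hw
    rw [Matrix.mem_unitaryGroup_iff] at hw
    rw [star_mul, star_smul, Matrix.mul_assoc, ← Matrix.mul_assoc (c • w), Matrix.smul_mul,
      Matrix.mul_smul, hw, smul_smul, Matrix.smul_mul, Matrix.one_mul, Matrix.mul_smul,
      Complex.star_def, Complex.mul_conj']
    congr 1
    ext i j
    fin_cases i <;> fin_cases j <;>
      simp [Matrix.mul_apply, Fin.sum_univ_two, Matrix.star_apply] <;> ring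
  have e := key a d x c w hw
  rw [← hk, ← hg, hg', hk', key a' d' x' c' w' hw'] at e
  have e11 := congrFun (congrFun e 1) 1
  have e01 := congrFun (congrFun e 0) 1
  have e00 := congrFun (congrFun e 0) 0
  simp only [Matrix.smul_apply, Matrix.of_apply, Matrix.cons_val, smul_eq_mul] at e11 e01 e00
  have hρ : 0 < ‖c‖ := norm_pos_iff.2 hc
  have hρ' : 0 < ‖c'‖ := norm_pos_iff.2 hc'
  have q1 : ‖c'‖ * d' = ‖c‖ * d := by
    have : (‖c'‖ * d') ^ 2 = (‖c‖ * d) ^ 2 := by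
      have : (((‖c'‖ * d') ^ 2 : ℝ) : ℂ) = ((‖c‖ * d) ^ 2 : ℝ) := by
        push_cast
        linear_combination e11
      exact_mod_cast this
    exact (pow_left_inj₀ (by positivity) (by positivity) two_ne_zero).1 this
  have q1C : (‖c'‖ : ℂ) * d' = ‖c‖ * d := by exact_mod_cast q1
  have hρdC : (‖c‖ : ℂ) * d ≠ 0 := by
    exact_mod_cast (mul_pos hρ hd).ne'
  have q2 : (‖c'‖ : ℂ) * x' = ‖c‖ * x := by
    apply mul_left_cancel₀ hρdC
    linear_combination e01 - (‖c'‖ : ℂ) * x' * q1C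
  have q2' : (‖c'‖ : ℂ) * conj x' = ‖c‖ * conj x := by
    have := congrArg conj q2
    simpa using this
  have q3 : ‖c'‖ * a' = ‖c‖ * a := by
    have : (‖c'‖ * a') ^ 2 = (‖c‖ * a) ^ 2 := by
      have : (((‖c'‖ * a') ^ 2 : ℝ) : ℂ) = ((‖c‖ * a) ^ 2 : ℝ) := by
        push_cast
        linear_combination e00 - (‖c'‖ : ℂ) * conj x' * q2 - (‖c‖ : ℂ) * x * q2'
      exact_mod_cast this
    exact (pow_left_inj₀ (by positivity) (by positivity) two_ne_zero).1 this
  have q3C : (‖c'‖ : ℂ) * a' = ‖c‖ * a := by exact_mod_cast q3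
  refine ⟨?_, ?_⟩
  · rw [div_eq_div_iff hd.ne' hd'.ne']
    apply mul_left_cancel₀ (mul_pos hρ hρ').ne'
    linear_combination ‖c‖ * a * q1 - ‖c‖ * d * q3
  · have hT : (‖c'‖ : ℂ) • !![(a' : ℂ), x'; 0, (d' : ℂ)] =
        (‖c‖ : ℂ) • !![(a : ℂ), x; 0, (d : ℂ)] := by
      ext i j
      fin_cases i <;> fin_cases j <;> simp [q1C, q2, q3C]
    have hkk : (‖c‖ : ℂ) • (k' : Matrix (Fin 2) (Fin 2) ℂ) =
        (‖c'‖ : ℂ) • (k : Matrix (Fin 2) (Fin 2) ℂ) := by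
      have hTdet : IsUnit (!![(a : ℂ), x; 0, (d : ℂ)]) := by
        rw [Matrix.isUnit_iff_isUnit_det, Matrix.det_fin_two_of, isUnit_iff_ne_zero]
        simp [ha.ne', hd.ne']
      apply hTdet.mul_left_cancel
      rw [Matrix.mul_smul, ← Matrix.smul_mul, ← hT, Matrix.smul_mul, ← hg', Matrix.mul_smul, ← hg]
    have hcC : (‖c‖ : ℂ) ≠ 0 := by exact_mod_cast hρ.ne'
    have hcC' : (‖c'‖ : ℂ) ≠ 0 := by exact_mod_cast hρ'.ne'
    have hk2 : (k' : Matrix (Fin 2) (Fin 2) ℂ) =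
        ((‖c‖ : ℂ)⁻¹ * ‖c'‖) • (k : Matrix (Fin 2) (Fin 2) ℂ) := by
      rw [mul_smul, ← hkk, smul_smul, inv_mul_cancel₀ hcC, one_smul]
    rw [Units.eq_mul_inv_iff_mul_eq, hk2, Matrix.mul_smul, Matrix.smul_mul, Matrix.mul_assoc,
      Units.inv_mul, Matrix.mul_one]

/-- The quotient `a / d > 0` in an Iwasawa decomposition `g = (a x; 0 d) k`. -/
def iwasawaRatio (g : GL (Fin 2) ℂ) : ℝ :=
  (exists_isIwasawa g).choose / (exists_isIwasawa g).choose_spec.choose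

/-- The component `k ∈ K_∞` in an Iwasawa decomposition `g = (a x; 0 d) k`. -/
def iwasawaK (g : GL (Fin 2) ℂ) : GL (Fin 2) ℂ :=
  (exists_isIwasawa g).choose_spec.choose_spec.choose_spec.choose

/-! ## The adelic Eisenstein operator -/

section AdelicEis

variable {K : Type*} [Field K] [NumberField K]

/-- `Ad(k) X = k X k⁻¹`. -/
def Ad (k : GL (Fin 2) ℂ) (X : Matrix (Fin 2) (Fin 2) ℂ) : Matrix (Fin 2) (Fin 2) ℂ :=
  (k : Matrix (Fin 2) (Fin 2) ℂ) * X * (k⁻¹ : GL (Fin 2) ℂ)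

/-- `ω̃_{Ψ,s}[X](g) = |a/d|^{1+s} Ψ(g_f) Š(Ad(k) X)` for `g_∞ = (a x; 0 d) k` with `a, d > 0` and
`k ∈ K_∞`.  It is applied to `X ∈ 𝔭` only. -/
def omegaTilde (Ψ : GL (Fin 2) (Af K) → ℂ) (s : ℂ) (X : Matrix (Fin 2) (Fin 2) ℂ) (g : GA K) : ℂ :=
  (iwasawaRatio g.1 : ℂ) ^ (1 + s) * Ψ g.2 * Scheck (Ad (iwasawaK g.1) X)

/-- The value of `ω̃_{Ψ,s}` does not depend on the Iwasawa decomposition. -/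
theorem omegaTilde_eq (Ψ : GL (Fin 2) (Af K) → ℂ) (s : ℂ) (X : Matrix (Fin 2) (Fin 2) ℂ) (g : GA K)
    {a d : ℝ} {x : ℂ} {k : GL (Fin 2) ℂ} (h : IsIwasawa g.1 a d x k) :
    omegaTilde Ψ s X g = ((a / d : ℝ) : ℂ) ^ (1 + s) * Ψ g.2 * Scheck (Ad k X) := by
  have h0 := (exists_isIwasawa g.1).choose_spec.choose_spec.choose_spec.choose_spec
  obtain ⟨h1, h2⟩ := h0.unique h X
  unfold omegaTilde iwasawaRatio iwasawaK Ad
  rw [h1, h2]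

/-- The term `ω̃[X](γ g)` of the adelic Eisenstein series, on a class `B(ℚ) γ`. -/
def adelicTerm (σ : K →+* ℂ) (F : Matrix (Fin 2) (Fin 2) ℂ → GA K → ℂ)
    (X : Matrix (Fin 2) (Fin 2) ℂ) (g : GA K)
    (q : Quotient (QuotientGroup.rightRel (borel K))) : ℂ :=
  F X (rational σ q.out * g)

/-- The Eisenstein operator `Eis(ω̃)[X](g) = ∑_{γ ∈ B(ℚ) \ G(ℚ)} ω̃[X](γ g)`. -/
def adelicEis (σ : K →+* ℂ) (F : Matrix (Fin 2) (Fin 2) ℂ → GA K → ℂ)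
    (X : Matrix (Fin 2) (Fin 2) ℂ) (g : GA K) : ℂ :=
  ∑' q, adelicTerm σ F X g q

/-- The vector `d_u L_{g⁻¹} ξ` of the tangent space at `j`, seen in `𝔭`, for a tangent vector `ξ` at
the point `u = g j` of hyperbolic 3-space.  The 1-form that corresponds to a left `G(ℚ)`-invariant
`ω̃` has the value `ω̃[toLie g u ξ](g, 1)` on `ξ`. -/
def toLie (g : GL (Fin 2) ℂ) (u ξ : ℂ × ℝ) : Matrix (Fin 2) (Fin 2) ℂ :=
  tangentEquiv.symm
    (fderiv ℝ (act ((g⁻¹ : GL (Fin 2) ℂ) : Matrix (Fin 2) (Fin 2) ℂ)) u ξ)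

end AdelicEis

end Bianchi

end

set_option linter.unusedSectionVars false

noncomputable section

namespace Bianchi

/-! ## The action on hyperbolic three-space -/

/-! The two Eisenstein series agree term by term. At infinity, `K_∞` fixes `j`, and at `j` the form
`dz` takes the value `2 Š(X)` on the tangent vector of `X`. Hence `|a/d|^{1+s} Š(Ad(k) X)` is half
the pull-back of `v^s dz` to `j`: the exponent `s` comes from the height, the additional `1` from
the factor by which `(a x; 0 d)` scales `dz`. Transporting from `j` to `u = g j` by the chain rule
turns a summand of the adelic series into `½ Ψ(y) (δ^* v^s dz)_u(ξ)` (`IsIwasawa.cpow_mul_Scheck`,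
`omegaTilde_eq_pullback`).

Left `B(ℚ)`-invariance is a cancellation between infinity and the finite places: the Hecke
characters are trivial on `Kˣ`, and the product formula reads `|x|_f |σ x|² = 1`, which is why `s/2`
at the finite places matches `s` at infinity (`omegaTilde_rational_mul`).

Class number one gives `GL₂(K) = B(K) SL₂(𝓞)`, so the summation sets `B(ℚ) \ G(ℚ)` and `Γ_∞ \ Γ`
correspond (`bijective_coset`). On representatives in `Γ` the finite factor is constant: the level
group is cut out of `GL₂(𝓞̂)` by a condition on determinants, so conjugates of `SL₂` lie in it
(`apply_mul_of_det_eq_one`).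

Since `χ` is unramified and `χ_∞(z) = z²`, every unit of `𝓞` has square one. Therefore `Γ_∞ = ±
N_∞`, which gives the invariance of `v^s dz` and accounts for `¼` against `½`.

For convergence, a `K_∞`-invariant norm on `𝔭` bounds `δ^*(v^s dz)` by a multiple of `v(δ u)^{1 + Re
s}`. Bottom rows embed `N_∞ \ Γ` in the rank four lattice `𝓞²`, and the sum of `‖(c, d)‖^{-2(1 + Re
s)}` over it is finite when `Re s > 1` (`exists_norm_pullback_le`,
`summable_classicalTerm_unipInfty`). The other series inherit convergence, and the identity theorem
along flat sections gives the continuation. -/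

/-- The automorphy factor `‖c z + d‖² + ‖c‖² v²`. -/
def actDenom (g : Matrix (Fin 2) (Fin 2) ℂ) (u : ℂ × ℝ) : ℝ :=
  ‖g 1 0 * u.1 + g 1 1‖ ^ 2 + ‖g 1 0‖ ^ 2 * u.2 ^ 2

theorem act_fst (g : Matrix (Fin 2) (Fin 2) ℂ) (u : ℂ × ℝ) :
    (act g u).1 = ((g 0 0 * u.1 + g 0 1) * conj (g 1 0 * u.1 + g 1 1) +
      g 0 0 * conj (g 1 0) * (u.2 : ℂ) ^ 2) / (actDenom g u : ℂ) := rfl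

theorem act_snd (g : Matrix (Fin 2) (Fin 2) ℂ) (u : ℂ × ℝ) :
    (act g u).2 = ‖g.det‖ * u.2 / actDenom g u := rfl

theorem actDenom_pos {g : Matrix (Fin 2) (Fin 2) ℂ} (hg : g.det ≠ 0) {u : ℂ × ℝ} (hu : 0 < u.2) :
    0 < actDenom g u := by
  unfold actDenom
  by_cases h : g 1 0 = 0
  · have : g 1 1 ≠ 0 := by
      intro h'
      apply hg
      rw [Matrix.det_fin_two, h, h']
      simp
    rw [h]
    have := norm_pos_iff.2 this
    simp only [zero_mul, zero_add, norm_zero]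
    positivity
  · have := norm_pos_iff.2 h
    positivity

theorem act_snd_pos {g : Matrix (Fin 2) (Fin 2) ℂ} (hg : g.det ≠ 0) {u : ℂ × ℝ} (hu : 0 < u.2) :
    0 < (act g u).2 := by
  rw [act_snd]
  have := norm_pos_iff.2 hg
  have := actDenom_pos hg hu
  positivity

theorem ofReal_actDenom (g : Matrix (Fin 2) (Fin 2) ℂ) (u : ℂ × ℝ) :
    (actDenom g u : ℂ) = (g 1 0 * u.1 + g 1 1) * (conj (g 1 0) * conj u.1 + conj (g 1 1)) +
      g 1 0 * conj (g 1 0) * (u.2 : ℂ) ^ 2 := by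
  simp only [actDenom, Complex.ofReal_add, Complex.ofReal_mul, Complex.ofReal_pow]
  rw [← Complex.mul_conj', ← Complex.mul_conj', map_add, map_mul]

theorem ofReal_norm_det_sq (g : Matrix (Fin 2) (Fin 2) ℂ) :
    (‖g.det‖ : ℂ) ^ 2 = (g 0 0 * g 1 1 - g 0 1 * g 1 0) *
      (conj (g 0 0) * conj (g 1 1) - conj (g 0 1) * conj (g 1 0)) := by
  rw [← Complex.mul_conj', Matrix.det_fin_two, map_sub, map_mul, map_mul]

/-- The cocycle relation for the norm of the quaternion `c u + d`. Once denominators are cleared it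
is a polynomial identity in the entries, the coordinates and their conjugates, `‖det h‖²` being
written as `det h` times its conjugate. -/
theorem actDenom_mul (g : Matrix (Fin 2) (Fin 2) ℂ) {h : Matrix (Fin 2) (Fin 2) ℂ}
    (hh : h.det ≠ 0) {u : ℂ × ℝ} (hu : 0 < u.2) :
    actDenom (g * h) u = actDenom g (act h u) * actDenom h u := by
  have hN : (actDenom h u : ℂ) ≠ 0 := by exact_mod_cast (actDenom_pos hh hu).ne'
  apply Complex.ofReal_injective
  rw [Complex.ofReal_mul, ofReal_actDenom (g * h), ofReal_actDenom g, act_fst, act_snd]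
  simp only [map_div₀, Complex.conj_ofReal, map_add, map_mul, Complex.conj_conj, map_pow,
    Complex.ofReal_div, Complex.ofReal_mul, div_pow, mul_pow, ofReal_norm_det_sq,
    Matrix.mul_apply, Fin.sum_univ_two]
  field_simp
  rw [ofReal_actDenom h]
  ring

theorem act_mul {g h : Matrix (Fin 2) (Fin 2) ℂ} (hg : g.det ≠ 0)
    (hh : h.det ≠ 0) {u : ℂ × ℝ} (hu : 0 < u.2) : act (g * h) u = act g (act h u) := by
  have hN : (actDenom h u : ℂ) ≠ 0 := by exact_mod_cast (actDenom_pos hh hu).ne'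
  have hN' : (actDenom g (act h u) : ℂ) ≠ 0 := by
    exact_mod_cast (actDenom_pos hg (act_snd_pos hh hu)).ne'
  have hmul := actDenom_mul g hh hu
  refine Prod.ext ?_ ?_
  · rw [act_fst (g * h), act_fst g, hmul, Complex.ofReal_mul, div_eq_div_iff (mul_ne_zero hN' hN) hN']
    -- By the cocycle relation only the numerators remain to be compared, up to the factor `actDenom
    -- h u`.
    suffices H : ((g * h) 0 0 * u.1 + (g * h) 0 1) * conj ((g * h) 1 0 * u.1 + (g * h) 1 1) +
        (g * h) 0 0 * conj ((g * h) 1 0) * (u.2 : ℂ) ^ 2 =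
        ((g 0 0 * (act h u).1 + g 0 1) * conj (g 1 0 * (act h u).1 + g 1 1) +
          g 0 0 * conj (g 1 0) * ((act h u).2 : ℂ) ^ 2) * (actDenom h u : ℂ) by
      rw [H]; ring
    rw [act_fst h, act_snd h]
    simp only [map_div₀, Complex.conj_ofReal, map_add, map_mul, Complex.conj_conj, map_pow,
      Complex.ofReal_div, Complex.ofReal_mul, div_pow, mul_pow, ofReal_norm_det_sq,
      Matrix.mul_apply, Fin.sum_univ_two]
    field_simp
    rw [ofReal_actDenom h]
    ring
  · rw [act_snd (g * h), act_snd g, act_snd h, hmul, Matrix.det_mul, norm_mul]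
    have h1 := (actDenom_pos hh hu).ne'
    have h2 := (actDenom_pos hg (act_snd_pos hh hu)).ne'
    field_simp

theorem act_one (u : ℂ × ℝ) : act 1 u = u := by
  simp [act]

theorem differentiableAt_act {g : Matrix (Fin 2) (Fin 2) ℂ} (hg : g.det ≠ 0) {u : ℂ × ℝ}
    (hu : 0 < u.2) : DifferentiableAt ℝ (act g) u := by
  have hN := (actDenom_pos hg hu).ne'
  have hconj : ∀ f : ℂ × ℝ → ℂ, DifferentiableAt ℝ f u →
      DifferentiableAt ℝ (fun x => conj (f x)) u := fun f hf =>
    (Complex.conjCLE.differentiableAt (x := f u)).comp u hf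
  have hofReal : ∀ f : ℂ × ℝ → ℝ, DifferentiableAt ℝ f u →
      DifferentiableAt ℝ (fun x => (f x : ℂ)) u := fun f hf =>
    (Complex.ofRealCLM.differentiableAt (x := f u)).comp u hf
  have hfst : DifferentiableAt ℝ (fun x : ℂ × ℝ => x.1) u := differentiableAt_fst
  have hsnd : DifferentiableAt ℝ (fun x : ℂ × ℝ => x.2) u := differentiableAt_snd
  have hden : DifferentiableAt ℝ (actDenom g) u := by
    unfold actDenom
    refine DifferentiableAt.add ?_ (by fun_prop)
    exact DifferentiableAt.norm_sq ℝ (by fun_prop)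
  refine DifferentiableAt.prodMk ?_ ?_
  · refine DifferentiableAt.mul ?_ ((hofReal _ hden).inv (by exact_mod_cast hN))
    refine DifferentiableAt.add ?_ ?_
    · exact DifferentiableAt.mul (by fun_prop) (hconj _ (by fun_prop))
    · exact DifferentiableAt.mul (by fun_prop) ((hofReal _ hsnd).pow 2)
  · exact DifferentiableAt.mul (by fun_prop) (hden.inv hN)

theorem eventually_snd_pos {u : ℂ × ℝ} (hu : 0 < u.2) : ∀ᶠ x : ℂ × ℝ in nhds u, 0 < x.2 :=
  continuous_snd.continuousAt.eventually (lt_mem_nhds hu)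

theorem fderiv_act_mul {g h : Matrix (Fin 2) (Fin 2) ℂ} (hg : g.det ≠ 0)
    (hh : h.det ≠ 0) {u : ℂ × ℝ} (hu : 0 < u.2) :
    fderiv ℝ (act (g * h)) u = (fderiv ℝ (act g) (act h u)).comp (fderiv ℝ (act h) u) := by
  have : act (g * h) =ᶠ[nhds u] act g ∘ act h := by
    filter_upwards [eventually_snd_pos hu] with x hx using act_mul hg hh hx
  rw [this.fderiv_eq]
  exact fderiv_comp u (differentiableAt_act hg (act_snd_pos hh hu)) (differentiableAt_act hh hu)

theorem pullback_mul {g h : Matrix (Fin 2) (Fin 2) ℂ} (hg : g.det ≠ 0)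
    (hh : h.det ≠ 0) (ω : ℂ × ℝ → (ℂ × ℝ →L[ℝ] ℂ)) {u : ℂ × ℝ} (hu : 0 < u.2) :
    pullback (g * h) ω u = (pullback g ω (act h u)).comp (fderiv ℝ (act h) u) := by
  unfold pullback
  rw [fderiv_act_mul hg hh hu, act_mul hg hh hu, ContinuousLinearMap.comp_assoc]

theorem pullback_mul_of_invariant {g h : Matrix (Fin 2) (Fin 2) ℂ} (hg : g.det ≠ 0)
    (hh : h.det ≠ 0) (ω : ℂ × ℝ → (ℂ × ℝ →L[ℝ] ℂ))
    (hω : ∀ u : ℂ × ℝ, 0 < u.2 → pullback g ω u = ω u) {u : ℂ × ℝ} (hu : 0 < u.2) :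
    pullback (g * h) ω u = pullback h ω u := by
  rw [pullback_mul hg hh ω hu, hω _ (act_snd_pos hh hu)]
  rfl

/-- Upper triangular matrices act by affine maps. -/
theorem act_upper {g : Matrix (Fin 2) (Fin 2) ℂ} (h : g 1 0 = 0) (hg : g.det ≠ 0) (u : ℂ × ℝ) :
    act g u = (g 0 0 / g 1 1 * u.1 + g 0 1 / g 1 1, ‖g 0 0 / g 1 1‖ * u.2) := by
  have hd : g 1 1 ≠ 0 := by
    rintro h'
    exact hg (by rw [Matrix.det_fin_two, h, h']; simp)
  have hd' : conj (g 1 1) ≠ 0 := by simpa using hd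
  have hN : (actDenom g u : ℂ) = g 1 1 * conj (g 1 1) := by
    rw [ofReal_actDenom, h]; simp
  refine Prod.ext ?_ ?_
  · rw [act_fst, hN, h]
    simp only [zero_mul, zero_add, map_zero, mul_zero, add_zero]
    field_simp
  · have : ‖g 1 1‖ ≠ 0 := by simpa using hd
    rw [act_snd]
    simp only [actDenom, h, Matrix.det_fin_two, zero_mul, mul_zero, zero_add, norm_zero, sub_zero,
      norm_mul, norm_div]
    field_simp
    ring

theorem fderiv_act_upper {g : Matrix (Fin 2) (Fin 2) ℂ} (h : g 1 0 = 0) (hg : g.det ≠ 0)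
    (u ξ : ℂ × ℝ) :
    fderiv ℝ (act g) u ξ = (g 0 0 / g 1 1 * ξ.1, ‖g 0 0 / g 1 1‖ * ξ.2) := by
  let A : ℂ × ℝ →L[ℝ] ℂ × ℝ :=
    ((g 0 0 / g 1 1) • ContinuousLinearMap.fst ℝ ℂ ℝ).prod
      (‖g 0 0 / g 1 1‖ • ContinuousLinearMap.snd ℝ ℂ ℝ)
  have : act g = fun x => A x + (g 0 1 / g 1 1, 0) := by
    funext x
    rw [act_upper h hg]
    simp [A]
  rw [this, fderiv_add_const, A.fderiv]
  simp [A]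

/-! ## The archimedean component -/

theorem GL_det_ne_zero (g : GL (Fin 2) ℂ) : (g : Matrix (Fin 2) (Fin 2) ℂ).det ≠ 0 :=
  g.det.ne_zero

theorem basePt_snd_pos : 0 < basePt.2 := one_pos

theorem Kinf_mul {k k' : GL (Fin 2) ℂ} (hk : k ∈ Kinf) (hk' : k' ∈ Kinf) : k * k' ∈ Kinf := by
  obtain ⟨c, hc, w, hw, h⟩ := hk
  obtain ⟨c', hc', w', hw', h'⟩ := hk'
  refine ⟨c * c', mul_ne_zero hc hc', w * w', mul_mem hw hw', ?_⟩
  rw [Units.val_mul, h, h', Matrix.smul_mul, Matrix.mul_smul, smul_smul]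

theorem Ad_mul (k k' : GL (Fin 2) ℂ) (X : Matrix (Fin 2) (Fin 2) ℂ) :
    Ad (k * k') X = Ad k (Ad k' X) := by
  simp only [Ad, mul_inv_rev, Units.val_mul, Matrix.mul_assoc]

theorem Ad_eq_of_eq_smul {k : GL (Fin 2) ℂ} {c : ℂ} (hc : c ≠ 0) {w : Matrix (Fin 2) (Fin 2) ℂ}
    (hw : w ∈ Matrix.unitaryGroup (Fin 2) ℂ) (hk : (k : Matrix (Fin 2) (Fin 2) ℂ) = c • w)
    (X : Matrix (Fin 2) (Fin 2) ℂ) : Ad k X = w * X * wᴴ := by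
  have hinv : ((k⁻¹ : GL (Fin 2) ℂ) : Matrix (Fin 2) (Fin 2) ℂ) = c⁻¹ • wᴴ := by
    symm
    refine Units.eq_inv_of_mul_eq_one_left ?_
    rw [hk, Matrix.smul_mul, Matrix.mul_smul, smul_smul,
      mul_inv_cancel₀ hc, one_smul]
    exact Matrix.mem_unitaryGroup_iff.1 hw
  rw [Ad, hinv, hk, Matrix.smul_mul, Matrix.smul_mul, Matrix.mul_smul, smul_smul,
    mul_inv_cancel₀ hc, one_smul]

theorem Ad_mem_𝔭 {k : GL (Fin 2) ℂ} (hk : k ∈ Kinf) {X : Matrix (Fin 2) (Fin 2) ℂ} (hX : X ∈ 𝔭) :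
    Ad k X ∈ 𝔭 := by
  obtain ⟨c, hc, w, hw, h⟩ := hk
  rw [Ad_eq_of_eq_smul hc hw h]
  obtain ⟨h1, h2⟩ := hX
  refine ⟨?_, ?_⟩
  · rw [Matrix.IsHermitian, Matrix.conjTranspose_mul, Matrix.conjTranspose_mul,
      Matrix.conjTranspose_conjTranspose, h1, Matrix.mul_assoc]
  · have : wᴴ * w = 1 := Matrix.mem_unitaryGroup_iff'.1 hw
    rw [Matrix.trace_mul_comm, ← Matrix.mul_assoc, this, Matrix.one_mul, h2]

/-- At `j` the denominator of the action is the squared length of the bottom row and the numerator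
is the Hermitian product of the two rows, so orthonormality of the rows and `‖det w‖ = 1` suffice.
-/
theorem act_basePt_of_mem_Kinf {k : GL (Fin 2) ℂ} (hk : k ∈ Kinf) :
    act (k : Matrix (Fin 2) (Fin 2) ℂ) basePt = basePt := by
  obtain ⟨c, hc, w, hw, h⟩ := hk
  rw [h]
  have hww : w * star w = 1 := Matrix.mem_unitaryGroup_iff.1 hw
  have h01 := congrFun (congrFun hww 0) 1
  have h11 := congrFun (congrFun hww 1) 1
  simp only [Matrix.mul_apply, Fin.sum_univ_two, Matrix.star_apply, Complex.star_def,
    Matrix.one_apply, Fin.isValue, zero_ne_one, if_false, if_true] at h01 h11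
  have hdet : ‖w.det‖ = 1 := by
    have := congrArg Matrix.det hww
    rw [Matrix.det_mul, Matrix.star_eq_conjTranspose, Matrix.det_conjTranspose, Matrix.det_one,
      Complex.star_def, Complex.mul_conj'] at this
    have h2 : ‖w.det‖ ^ 2 = 1 := by exact_mod_cast this
    exact (pow_eq_one_iff_of_nonneg (norm_nonneg _) two_ne_zero).1 h2
  have hcn : ‖c‖ ≠ 0 := by simpa using hc
  have hN : actDenom (c • w) basePt = ‖c‖ ^ 2 := by
    apply Complex.ofReal_injective
    rw [ofReal_actDenom, Complex.ofReal_pow, ← Complex.mul_conj']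
    simp only [basePt, Matrix.smul_apply, smul_eq_mul, map_mul, map_zero, Complex.ofReal_one]
    linear_combination c * conj c * h11
  refine Prod.ext ?_ ?_
  · rw [act_fst]
    simp only [basePt, Matrix.smul_apply, smul_eq_mul, map_mul, Complex.ofReal_one]
    rw [div_eq_zero_iff]
    left
    simp only [map_add, map_mul, map_zero]
    linear_combination c * conj c * h01
  · rw [act_snd, hN, Matrix.det_smul, norm_mul, hdet]
    simp [basePt, hcn]

/-- Since `k⁻¹` fixes `j`, the curves `k exp(tX) j` and `exp(t Ad(k) X) j` coincide; both sides are
their velocity at `t = 0`. -/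
theorem fderiv_act_basePt_of_mem_Kinf {k : GL (Fin 2) ℂ} (hk : k ∈ Kinf) (X : 𝔭) :
    fderiv ℝ (act (k : Matrix (Fin 2) (Fin 2) ℂ)) basePt (tangentEquiv X) =
      tangentEquiv ⟨Ad k X, Ad_mem_𝔭 hk X.2⟩ := by
  have hdetexp : ∀ A : Matrix (Fin 2) (Fin 2) ℂ, (NormedSpace.exp A).det ≠ 0 := by
    intro A
    exact ((Matrix.isUnit_iff_isUnit_det _).1 (Matrix.isUnit_exp A)).ne_zero
  have h1 := tangentEquiv_hasDerivAt X
  have h2 := tangentEquiv_hasDerivAt ⟨Ad k X, Ad_mem_𝔭 hk X.2⟩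
  have hd : HasFDerivAt (act (k : Matrix (Fin 2) (Fin 2) ℂ))
      (fderiv ℝ (act (k : Matrix (Fin 2) (Fin 2) ℂ)) basePt)
      (act (NormedSpace.exp ((0 : ℝ) • (X : Matrix (Fin 2) (Fin 2) ℂ))) basePt) := by
    rw [zero_smul, NormedSpace.exp_zero, act_one]
    exact (differentiableAt_act (GL_det_ne_zero k) basePt_snd_pos).hasFDerivAt
  have hAd : ∀ t : ℝ, NormedSpace.exp (t • Ad k X) =
      (k : Matrix (Fin 2) (Fin 2) ℂ) * NormedSpace.exp (t • (X : Matrix (Fin 2) (Fin 2) ℂ)) *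
        ((k⁻¹ : GL (Fin 2) ℂ) : Matrix (Fin 2) (Fin 2) ℂ) := by
    intro t
    rw [← Matrix.exp_units_conj, Ad, Matrix.mul_smul, Matrix.smul_mul]
  have hkinv : act ((k⁻¹ : GL (Fin 2) ℂ) : Matrix (Fin 2) (Fin 2) ℂ) basePt = basePt := by
    conv_lhs => rw [← act_basePt_of_mem_Kinf hk]
    rw [← act_mul (GL_det_ne_zero _) (GL_det_ne_zero _) basePt_snd_pos, Units.inv_mul, act_one]
  have heq : (fun t : ℝ => act (k : Matrix (Fin 2) (Fin 2) ℂ)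
      (act (NormedSpace.exp (t • (X : Matrix (Fin 2) (Fin 2) ℂ))) basePt)) =
      fun t : ℝ => act (NormedSpace.exp (t • Ad k X)) basePt := by
    funext t
    rw [← act_mul (GL_det_ne_zero _) (hdetexp _) basePt_snd_pos, hAd,
      act_mul _ (GL_det_ne_zero _) basePt_snd_pos, hkinv]
    rw [Matrix.det_mul]
    exact mul_ne_zero (GL_det_ne_zero _) (hdetexp _)
  have h3 := hd.comp_hasDerivAt (0 : ℝ) h1
  rw [Function.comp_def, heq] at h3
  exact h3.unique h2

/-- The infinite component of `ω̃` is half the pull-back of `v ^ s dz`. -/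
theorem IsIwasawa.cpow_mul_Scheck {h k : GL (Fin 2) ℂ} {a d : ℝ} {x : ℂ}
    (hi : IsIwasawa h a d x k) (s : ℂ) (X : 𝔭) :
    ((a / d : ℝ) : ℂ) ^ (1 + s) * Scheck (Ad k X) =
      1 / 2 * pullback (h : Matrix (Fin 2) (Fin 2) ℂ) (vsdz s) basePt (tangentEquiv X) := by
  obtain ⟨ha, hd, hk, hg⟩ := hi
  set b : Matrix (Fin 2) (Fin 2) ℂ := !![(a : ℂ), x; 0, (d : ℂ)] with hb
  have hdC : (d : ℂ) ≠ 0 := by exact_mod_cast hd.ne'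
  have haC : (a : ℂ) ≠ 0 := by exact_mod_cast ha.ne'
  have hbdet : b.det ≠ 0 := by
    rw [hb, Matrix.det_fin_two_of]
    simp [haC, hdC]
  have hb10 : b 1 0 = 0 := by simp [hb]
  have hpos : 0 < a / d := div_pos ha hd
  have hposC : ((a / d : ℝ) : ℂ) ≠ 0 := by exact_mod_cast hpos.ne'
  rw [hg, pullback_mul hbdet (GL_det_ne_zero k) _ basePt_snd_pos, act_basePt_of_mem_Kinf hk,
    ContinuousLinearMap.comp_apply, fderiv_act_basePt_of_mem_Kinf hk, pullback,
    ContinuousLinearMap.comp_apply, fderiv_act_upper hb10 hbdet, act_upper hb10 hbdet, vsdz]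
  have hnorm : ‖b 0 0 / b 1 1‖ = a / d := by
    simp [hb, abs_of_pos ha, abs_of_pos hd]
  have hq : b 0 0 / b 1 1 = ((a / d : ℝ) : ℂ) := by simp [hb]
  rw [hnorm, hq]
  simp only [basePt, mul_one, smul_apply, ContinuousLinearMap.coe_fst',
    smul_eq_mul]
  -- The power `s` is that of the height `a / d`, the extra factor `a / d` is the scaling of `dz`,
  -- and `1 / 2` cancels the `2` in `tangentEquiv`.
  rw [Complex.cpow_add _ _ hposC, Complex.cpow_one]
  change _ * (Ad k X) 0 1 = 1 / 2 * (_ * (_ * (2 * (Ad k X) 0 1)))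
  ring

theorem toLie_eq (g : GL (Fin 2) ℂ) (u ξ : ℂ × ℝ) : ∃ X : 𝔭, toLie g u ξ = X ∧
    tangentEquiv X = fderiv ℝ (act ((g⁻¹ : GL (Fin 2) ℂ) : Matrix (Fin 2) (Fin 2) ℂ)) u ξ :=
  ⟨_, rfl, LinearEquiv.apply_symm_apply _ _⟩

/-- Chain rule for `δ = (δ g) g⁻¹`, where `g⁻¹` carries `u` to `j`. -/
theorem pullback_tangentEquiv {g : GL (Fin 2) ℂ} {u : ℂ × ℝ} (hu : 0 < u.2)
    (hg : act (g : Matrix (Fin 2) (Fin 2) ℂ) basePt = u) (δ : GL (Fin 2) ℂ)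
    (ω : ℂ × ℝ → (ℂ × ℝ →L[ℝ] ℂ)) (ξ : ℂ × ℝ) :
    pullback ((δ * g : GL (Fin 2) ℂ) : Matrix (Fin 2) (Fin 2) ℂ) ω basePt
        (fderiv ℝ (act ((g⁻¹ : GL (Fin 2) ℂ) : Matrix (Fin 2) (Fin 2) ℂ)) u ξ) =
      pullback (δ : Matrix (Fin 2) (Fin 2) ℂ) ω u ξ := by
  have hinv : act ((g⁻¹ : GL (Fin 2) ℂ) : Matrix (Fin 2) (Fin 2) ℂ) u = basePt := by
    rw [← hg, ← act_mul (GL_det_ne_zero _) (GL_det_ne_zero _) basePt_snd_pos, Units.inv_mul,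
      act_one]
  have := pullback_mul (GL_det_ne_zero (δ * g)) (GL_det_ne_zero g⁻¹) ω hu
  rw [← Units.val_mul, mul_inv_cancel_right, hinv] at this
  rw [this, ContinuousLinearMap.comp_apply]

variable {K : Type*} [Field K] [NumberField K]

theorem omegaTilde_eq_pullback (Ψ : GL (Fin 2) (Af K) → ℂ) (s : ℂ) (g δ : GL (Fin 2) ℂ)
    {u : ℂ × ℝ} (hu : 0 < u.2) (hg : act (g : Matrix (Fin 2) (Fin 2) ℂ) basePt = u)
    (ξ : ℂ × ℝ) (y : GL (Fin 2) (Af K)) :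
    omegaTilde Ψ s (toLie g u ξ) (δ * g, y) =
      1 / 2 * Ψ y * pullback (δ : Matrix (Fin 2) (Fin 2) ℂ) (vsdz s) u ξ := by
  obtain ⟨X, hX, hX'⟩ := toLie_eq g u ξ
  obtain ⟨a, d, x, k, hi⟩ := exists_isIwasawa (δ * g)
  rw [hX, omegaTilde_eq Ψ s X (δ * g, y) hi, mul_right_comm, hi.cpow_mul_Scheck, hX',
    pullback_tangentEquiv hu hg]
  ring

/-- On `𝔭` the quantity `-det Z = ‖Z 0 1‖² + ‖Z 0 0‖²` is a norm form invariant under `Ad(K_∞)`.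
With `Y = Ad k X` this bounds `Š(Ad k X)` uniformly in `k`. -/
theorem norm_apply_zero_one_le {X Y : Matrix (Fin 2) (Fin 2) ℂ} (hX : X ∈ 𝔭) (hY : Y ∈ 𝔭)
    (h : X.det = Y.det) : ‖Y 0 1‖ ≤ ‖X 0 1‖ + ‖X 0 0‖ := by
  have key : ∀ Z ∈ 𝔭, (Z.det) = -((‖Z 0 1‖ ^ 2 + ‖Z 0 0‖ ^ 2 : ℝ) : ℂ) := by
    rintro Z ⟨h1, h2⟩
    rw [Matrix.trace_fin_two] at h2
    have h00 : conj (Z 0 0) = Z 0 0 := h1.apply 0 0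
    have h10 : conj (Z 0 1) = Z 1 0 := h1.apply 1 0
    push_cast
    rw [← Complex.mul_conj', ← Complex.mul_conj', h00, h10, Matrix.det_fin_two]
    linear_combination Z 0 0 * h2
  rw [key X hX, key Y hY, neg_inj] at h
  have h' : ‖X 0 1‖ ^ 2 + ‖X 0 0‖ ^ 2 = ‖Y 0 1‖ ^ 2 + ‖Y 0 0‖ ^ 2 := by exact_mod_cast h
  apply abs_le_of_sq_le_sq' _ (by positivity) |>.2
  nlinarith [sq_nonneg ‖Y 0 0‖, norm_nonneg (X 0 1), norm_nonneg (X 0 0)]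

theorem det_Ad (k : GL (Fin 2) ℂ) (X : Matrix (Fin 2) (Fin 2) ℂ) : (Ad k X).det = X.det := by
  rw [Ad, Matrix.det_units_conj]

/-- The pull-backs of `v ^ s dz` are bounded by the powers `v(δ u) ^ (1 + Re s)`. -/
theorem exists_norm_pullback_le {u : ℂ × ℝ} (hu : 0 < u.2) (s : ℂ) :
    ∃ C : ℝ, ∀ δ : GL (Fin 2) ℂ, ‖pullback (δ : Matrix (Fin 2) (Fin 2) ℂ) (vsdz s) u‖ ≤
      C * (act (δ : Matrix (Fin 2) (Fin 2) ℂ) u).2 ^ (1 + s.re) := by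
  obtain ⟨g, hg⟩ : ∃ g : GL (Fin 2) ℂ, act (g : Matrix (Fin 2) (Fin 2) ℂ) basePt = u := by
    have hu0 : (u.2 : ℂ) ≠ 0 := by exact_mod_cast hu.ne'
    have hdet : (!![(u.2 : ℂ), u.1; 0, 1] : Matrix (Fin 2) (Fin 2) ℂ).det ≠ 0 := by
      simpa [Matrix.det_fin_two_of] using hu0
    refine ⟨Matrix.GeneralLinearGroup.mkOfDetNeZero _ hdet, ?_⟩
    change act !![(u.2 : ℂ), u.1; 0, 1] basePt = u
    rw [act_upper (by simp) hdet]
    simp [basePt, abs_of_pos hu]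
  set D := fderiv ℝ (act ((g⁻¹ : GL (Fin 2) ℂ) : Matrix (Fin 2) (Fin 2) ℂ)) u
  -- The `2` undoes the `1 / 2` in the comparison with `ω̃`; `D` transports vectors from `u` to `j`,
  -- independently of `δ`.
  refine ⟨2 * ‖D‖, fun δ => ?_⟩
  obtain ⟨a, d, x, k, hi⟩ := exists_isIwasawa (δ * g)
  have hratio : (act (δ : Matrix (Fin 2) (Fin 2) ℂ) u).2 = a / d := by
    obtain ⟨ha, hd, hk, hgk⟩ := hi
    have hdC : (d : ℂ) ≠ 0 := by exact_mod_cast hd.ne'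
    have haC : (a : ℂ) ≠ 0 := by exact_mod_cast ha.ne'
    have hbdet : (!![(a : ℂ), x; 0, (d : ℂ)]).det ≠ 0 := by
      rw [Matrix.det_fin_two_of]
      simp [haC, hdC]
    rw [← hg, ← act_mul (GL_det_ne_zero _) (GL_det_ne_zero _) basePt_snd_pos, ← Units.val_mul,
      hgk, act_mul hbdet (GL_det_ne_zero _) basePt_snd_pos, act_basePt_of_mem_Kinf hk,
      act_upper (by simp) hbdet]
    simp [basePt, abs_of_pos ha, abs_of_pos hd]
  have hpos : 0 < a / d := div_pos hi.1 hi.2.1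
  have hk := hi.2.2.1
  refine ContinuousLinearMap.opNorm_le_bound _ (by rw [hratio]; positivity) fun ξ => ?_
  obtain ⟨X, hX, hX'⟩ := toLie_eq g u ξ
  have h1 := hi.cpow_mul_Scheck s X
  rw [hX', pullback_tangentEquiv hu hg] at h1
  have h2 : pullback (δ : Matrix (Fin 2) (Fin 2) ℂ) (vsdz s) u ξ =
      2 * (((a / d : ℝ) : ℂ) ^ (1 + s) * Scheck (Ad k X)) := by
    rw [h1]; ring
  have h3 : ‖Scheck (Ad k X)‖ ≤ ‖D ξ‖ := by
    refine (norm_apply_zero_one_le X.2 (Ad_mem_𝔭 hk X.2) (det_Ad k X).symm).trans ?_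
    -- Both coordinates of `tangentEquiv X` are twice matrix entries, so each entry costs at most
    -- half of `‖D ξ‖`.
    have e1 : ‖(tangentEquiv X).1‖ ≤ ‖D ξ‖ := by rw [hX']; exact norm_fst_le _
    have e2 : ‖(tangentEquiv X).2‖ ≤ ‖D ξ‖ := by rw [hX']; exact norm_snd_le _
    change ‖2 * X.1 0 1‖ ≤ _ at e1
    change ‖2 * (X.1 0 0).re‖ ≤ _ at e2
    have hre : ((X.1 0 0).re : ℂ) = X.1 0 0 := Complex.conj_eq_iff_re.mp (X.2.1.apply 0 0)
    have e3 : ‖X.1 0 0‖ = ‖(X.1 0 0).re‖ := by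
      conv_lhs => rw [← hre]
      rw [Complex.norm_real]
    rw [norm_mul] at e1 e2
    rw [e3]
    norm_num at e1 e2 ⊢
    linarith
  rw [h2, norm_mul, norm_mul, Complex.norm_cpow_eq_rpow_re_of_pos hpos, hratio]
  have h4 := D.le_opNorm ξ
  simp only [Complex.add_re, Complex.one_re, Complex.norm_ofNat]
  have h5 : 0 < (a / d) ^ (1 + s.re) := by positivity
  calc 2 * ((a / d) ^ (1 + s.re) * ‖Scheck (Ad k X)‖)
      ≤ 2 * ((a / d) ^ (1 + s.re) * (‖D‖ * ‖ξ‖)) := by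
        gcongr
        exact h3.trans h4
    _ = _ := by ring

section Adelic

variable {K : Type*} [Field K] [NumberField K]

/-! ## Norms of finite adèles -/

theorem Af_norm_le_one_iff {v : HeightOneSpectrum (𝓞 K)} {x : v.adicCompletion K} :
    ‖x‖ ≤ 1 ↔ Valued.v x ≤ 1 :=
  Valued.toNormedField.norm_le_one_iff

theorem Af_norm_eq_one_iff {v : HeightOneSpectrum (𝓞 K)} {x : v.adicCompletion K} :
    ‖x‖ = 1 ↔ Valued.v x = 1 := by
  have h1 : ‖x‖ ≤ 1 ↔ Valued.v x ≤ 1 := Valued.toNormedField.norm_le_one_iff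
  have h2 : 1 ≤ ‖x‖ ↔ 1 ≤ Valued.v x := Valued.toNormedField.one_le_norm_iff
  rw [le_antisymm_iff, le_antisymm_iff, h1, h2]

theorem Af_mul_apply (x y : Af K) (v : HeightOneSpectrum (𝓞 K)) : (x * y) v = x v * y v := rfl

theorem Af_one_apply (v : HeightOneSpectrum (𝓞 K)) : (1 : Af K) v = 1 := rfl

theorem Af_eventually_norm_le_one (x : Af K) : ∀ᶠ v in Filter.cofinite, ‖x v‖ ≤ 1 := by
  filter_upwards [x.2] with v hv
  exact Af_norm_le_one_iff.2 hv

theorem Af_eventually_norm_eq_one (x : (Af K)ˣ) :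
    ∀ᶠ v in Filter.cofinite, ‖(x : Af K) v‖ = 1 := by
  filter_upwards [(FiniteAdeleRing.isUnit_iff.1 x.isUnit).2] with v hv
  exact Af_norm_eq_one_iff.2 hv

theorem Af_units_apply_ne_zero (x : (Af K)ˣ) (v : HeightOneSpectrum (𝓞 K)) : (x : Af K) v ≠ 0 :=
  (FiniteAdeleRing.isUnit_iff.1 x.isUnit).1 v

theorem finite_mulSupport_norm (x : (Af K)ˣ) :
    (fun v => ‖(x : Af K) v‖).HasFiniteMulSupport :=
  Af_eventually_norm_eq_one x

theorem finprod_pos_of_pos {α : Type*} {f : α → ℝ} (h : ∀ x, 0 < f x) : 0 < ∏ᶠ x, f x :=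
  finprod_induction (fun x => 0 < x) one_pos (fun _ _ => mul_pos) h

theorem finNorm_pos (x : (Af K)ˣ) : 0 < finNorm (x : Af K) :=
  finprod_pos_of_pos fun v => norm_pos_iff.2 (Af_units_apply_ne_zero x v)

theorem finNorm_mul (x y : (Af K)ˣ) :
    finNorm ((x * y : (Af K)ˣ) : Af K) = finNorm (x : Af K) * finNorm (y : Af K) := by
  unfold finNorm
  rw [← finprod_mul_distrib (finite_mulSupport_norm x) (finite_mulSupport_norm y)]
  refine finprod_congr fun v => ?_
  rw [Units.val_mul, Af_mul_apply, norm_mul]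

theorem finNorm_div (x y : (Af K)ˣ) :
    finNorm ((x / y : (Af K)ˣ) : Af K) = finNorm (x : Af K) / finNorm (y : Af K) := by
  rw [eq_div_iff (finNorm_pos y).ne', ← finNorm_mul, div_mul_cancel]

theorem finNorm_eq_one {x : Af K} (h : ∀ v, ‖x v‖ = 1) : finNorm x = 1 :=
  finprod_eq_one_of_forall_eq_one h

/-- The product formula for an imaginary quadratic field. -/
theorem finNorm_mul_norm_sq [NumberField.IsTotallyComplex K] (hdeg : Module.finrank ℚ K = 2)
    (σ : K →+* ℂ) {x : K} (hx : x ≠ 0) : finNorm (algebraMap K (Af K) x) * ‖σ x‖ ^ 2 = 1 := by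
  -- There is a single infinite place, and it is complex; its multiplicity two is the exponent of
  -- `‖σ x‖`.
  have hcard : Fintype.card (NumberField.InfinitePlace K) = 1 := by
    have h1 := NumberField.InfinitePlace.card_add_two_mul_card_eq_rank K
    have h2 : NumberField.InfinitePlace.nrRealPlaces K = 0 :=
      NumberField.nrRealPlaces_eq_zero_iff.2 inferInstance
    rw [NumberField.InfinitePlace.card_eq_nrRealPlaces_add_nrComplexPlaces]
    omega
  have huniv : (Finset.univ : Finset (NumberField.InfinitePlace K)) =
      {NumberField.InfinitePlace.mk σ} := by
    symm
    apply Finset.eq_univ_of_card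
    rw [hcard, Finset.card_singleton]
  have h := NumberField.prod_abs_eq_one hx
  rw [huniv, Finset.prod_singleton, NumberField.InfinitePlace.apply,
    NumberField.IsTotallyComplex.mult_eq,
    ← finprod_comp_equiv NumberField.FinitePlace.equivHeightOneSpectrum.symm] at h
  rw [mul_comm]
  convert h using 2
  exact finprod_congr fun v =>
    (NumberField.FinitePlace.equivHeightOneSpectrum_symm_apply v x).symm

/-! ## Heights -/

theorem GL_Af_det_apply (g : GL (Fin 2) (Af K)) (v : HeightOneSpectrum (𝓞 K)) :
    (g : Matrix (Fin 2) (Fin 2) (Af K)).det v = g 0 0 v * g 1 1 v - g 0 1 v * g 1 0 v := by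
  rw [Matrix.det_fin_two]
  rfl

theorem GL_Af_mul_apply (g h : GL (Fin 2) (Af K)) (i j : Fin 2) (v : HeightOneSpectrum (𝓞 K)) :
    (g * h) i j v = g i 0 v * h 0 j v + g i 1 v * h 1 j v := by
  change ((g : Matrix (Fin 2) (Fin 2) (Af K)) * (h : Matrix (Fin 2) (Fin 2) (Af K))) i j v = _
  rw [Matrix.mul_apply, Fin.sum_univ_two]
  rfl

theorem GL_Af_det_ne_zero (g : GL (Fin 2) (Af K)) (v : HeightOneSpectrum (𝓞 K)) :
    (g : Matrix (Fin 2) (Fin 2) (Af K)).det v ≠ 0 :=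
  Af_units_apply_ne_zero g.det v

/-- The local norm of the bottom row. -/
def rowNorm (g : GL (Fin 2) (Af K)) (v : HeightOneSpectrum (𝓞 K)) : ℝ :=
  max ‖(g 1 0) v‖ ‖(g 1 1) v‖

theorem rowNorm_pos (g : GL (Fin 2) (Af K)) (v : HeightOneSpectrum (𝓞 K)) : 0 < rowNorm g v := by
  by_contra! h
  have h0 := norm_le_zero_iff.1 ((le_max_left _ _).trans h)
  have h1 := norm_le_zero_iff.1 ((le_max_right _ _).trans h)
  apply GL_Af_det_ne_zero g v
  rw [GL_Af_det_apply, h0, h1]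
  simp

/-- The determinant is a combination of the bottom row with integral coefficients, so by the
ultrametric inequality a unit determinant forces the row to be unimodular. -/
theorem rowNorm_eq_one {g : GL (Fin 2) (Af K)} {v : HeightOneSpectrum (𝓞 K)}
    (h : ∀ i j, ‖g i j v‖ ≤ 1) (hdet : ‖(g : Matrix (Fin 2) (Fin 2) (Af K)).det v‖ = 1) :
    rowNorm g v = 1 := by
  refine le_antisymm (max_le (h 1 0) (h 1 1)) ?_
  rw [← hdet, GL_Af_det_apply, sub_eq_add_neg]
  refine (IsUltrametricDist.norm_add_le_max _ _).trans (max_le ?_ ?_)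
  · rw [norm_mul]
    exact (mul_le_of_le_one_left (norm_nonneg _) (h 0 0)).trans (le_max_right _ _)
  · rw [norm_neg, norm_mul]
    exact (mul_le_of_le_one_left (norm_nonneg _) (h 0 1)).trans (le_max_left _ _)

theorem finite_mulSupport_rowNorm (g : GL (Fin 2) (Af K)) :
    (rowNorm g).HasFiniteMulSupport := by
  have : ∀ᶠ v in Filter.cofinite, rowNorm g v = 1 := by
    filter_upwards [Af_eventually_norm_le_one (g 0 0), Af_eventually_norm_le_one (g 0 1),
      Af_eventually_norm_le_one (g 1 0), Af_eventually_norm_le_one (g 1 1),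
      Af_eventually_norm_eq_one g.det] with v h1 h2 h3 h4 h5
    refine rowNorm_eq_one ?_ h5
    intro i j
    fin_cases i <;> fin_cases j <;> assumption
  exact this

theorem finHeight_def (g : GL (Fin 2) (Af K)) :
    finHeight g = finNorm (g.det : Af K) / (∏ᶠ v, rowNorm g v) ^ 2 := rfl

theorem finHeight_pos (g : GL (Fin 2) (Af K)) : 0 < finHeight g := by
  rw [finHeight_def]
  exact div_pos (finNorm_pos _) (pow_pos (finprod_pos_of_pos (rowNorm_pos g)) 2)

theorem det_upper {R : Type*} [CommRing R] (a d : Rˣ) (x : R) : (upper a d x).det = a * d := by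
  ext
  change (!![(a : R), x; 0, (d : R)]).det = _
  rw [Matrix.det_fin_two_of]
  simp

/-- The determinant is multiplied by `a d` and the bottom row by `d`, which enters squared; `a d /
d²` leaves `a / d`. -/
theorem finHeight_upper_mul (a d : (Af K)ˣ) (x : Af K) (g : GL (Fin 2) (Af K)) :
    finHeight (upper a d x * g) = finNorm ((a / d : (Af K)ˣ) : Af K) * finHeight g := by
  have hrow : ∀ v, rowNorm (upper a d x * g) v = ‖(d : Af K) v‖ * rowNorm g v := by
    intro v
    have h10 : (upper a d x) 1 0 v = 0 := rfl
    have h11 : (upper a d x) 1 1 v = (d : Af K) v := rfl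
    simp only [rowNorm, GL_Af_mul_apply, h10, h11, zero_mul, zero_add, norm_mul]
    exact (mul_max_of_nonneg _ _ (norm_nonneg _)).symm
  have hprod : ∏ᶠ v, rowNorm (upper a d x * g) v = finNorm (d : Af K) * ∏ᶠ v, rowNorm g v := by
    unfold finNorm
    rw [← finprod_mul_distrib (finite_mulSupport_norm d) (finite_mulSupport_rowNorm g)]
    exact finprod_congr hrow
  rw [finHeight_def, finHeight_def, hprod, map_mul, det_upper, finNorm_mul, finNorm_mul,
    finNorm_div]
  have h1 := (finNorm_pos d).ne'
  have h2 := (finprod_pos_of_pos (rowNorm_pos g)).ne'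
  field_simp

/-! ## The maximal compact subgroup -/

theorem norm_apply_le_one_of_mem_maxCompact {k : GL (Fin 2) (Af K)} (hk : k ∈ maxCompact K)
    (i j : Fin 2) (v : HeightOneSpectrum (𝓞 K)) : ‖k i j v‖ ≤ 1 :=
  Af_norm_le_one_iff.2 ((hk v).1 i j)

theorem norm_det_of_mem_maxCompact {k : GL (Fin 2) (Af K)} (hk : k ∈ maxCompact K)
    (v : HeightOneSpectrum (𝓞 K)) : ‖(k : Matrix (Fin 2) (Fin 2) (Af K)).det v‖ = 1 :=
  Af_norm_eq_one_iff.2 (hk v).2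

theorem mem_maxCompact_of_norm {k : GL (Fin 2) (Af K)} (h : ∀ i j v, ‖k i j v‖ ≤ 1)
    (h' : ∀ v, ‖(k : Matrix (Fin 2) (Fin 2) (Af K)).det v‖ = 1) : k ∈ maxCompact K := fun v =>
  ⟨fun i j => Af_norm_le_one_iff.1 (h i j v), Af_norm_eq_one_iff.1 (h' v)⟩

theorem norm_det_mul (k k' : GL (Fin 2) (Af K)) (v : HeightOneSpectrum (𝓞 K)) :
    ‖((k * k' : GL (Fin 2) (Af K)) : Matrix (Fin 2) (Fin 2) (Af K)).det v‖ =
      ‖(k : Matrix (Fin 2) (Fin 2) (Af K)).det v‖ *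
        ‖(k' : Matrix (Fin 2) (Fin 2) (Af K)).det v‖ := by
  rw [Units.val_mul, Matrix.det_mul, Af_mul_apply, norm_mul]

theorem maxCompact_mul {k k' : GL (Fin 2) (Af K)} (hk : k ∈ maxCompact K)
    (hk' : k' ∈ maxCompact K) : k * k' ∈ maxCompact K := by
  refine mem_maxCompact_of_norm (fun i j v => ?_) (fun v => ?_)
  · rw [GL_Af_mul_apply]
    refine (IsUltrametricDist.norm_add_le_max _ _).trans (max_le ?_ ?_) <;> rw [norm_mul] <;>
    exact mul_le_one₀ (norm_apply_le_one_of_mem_maxCompact hk _ _ v) (norm_nonneg _)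
      (norm_apply_le_one_of_mem_maxCompact hk' _ _ v)
  · rw [norm_det_mul, norm_det_of_mem_maxCompact hk, norm_det_of_mem_maxCompact hk', mul_one]

/-- The inverse is the adjugate divided by a determinant that is a unit at every place. -/
theorem maxCompact_inv {k : GL (Fin 2) (Af K)} (hk : k ∈ maxCompact K) :
    k⁻¹ ∈ maxCompact K := by
  have hdet := norm_det_of_mem_maxCompact hk
  have hadj : (k : Matrix (Fin 2) (Fin 2) (Af K)).adjugate =
      (k : Matrix (Fin 2) (Fin 2) (Af K)).det • ((k⁻¹ : GL (Fin 2) (Af K)) :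
        Matrix (Fin 2) (Fin 2) (Af K)) := by
    have := congrArg (· * ((k⁻¹ : GL (Fin 2) (Af K)) : Matrix (Fin 2) (Fin 2) (Af K)))
      (Matrix.adjugate_mul (k : Matrix (Fin 2) (Fin 2) (Af K)))
    simpa [Matrix.mul_assoc, -Matrix.coe_units_inv] using this
  refine mem_maxCompact_of_norm (fun i j v => ?_) (fun v => ?_)
  · have h1 : (k : Matrix (Fin 2) (Fin 2) (Af K)).adjugate i j v =
        (k : Matrix (Fin 2) (Fin 2) (Af K)).det v * (k⁻¹) i j v := by
      rw [hadj]; rfl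
    have h2 : ‖(k⁻¹) i j v‖ = ‖(k : Matrix (Fin 2) (Fin 2) (Af K)).adjugate i j v‖ := by
      rw [h1, norm_mul, hdet, one_mul]
    rw [h2, Matrix.adjugate_fin_two]
    have hk' := norm_apply_le_one_of_mem_maxCompact hk
    fin_cases i <;> fin_cases j
    · exact hk' 1 1 v
    · exact (norm_neg (k 0 1 v)).trans_le (hk' 0 1 v)
    · exact (norm_neg (k 1 0 v)).trans_le (hk' 1 0 v)
    · exact hk' 0 0 v
  · have := norm_det_mul k k⁻¹ v
    rw [hdet, one_mul, mul_inv_cancel, Units.val_one, Matrix.det_one, Af_one_apply, norm_one] at this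
    exact this.symm

theorem rowNorm_mul_le (g : GL (Fin 2) (Af K)) {k : GL (Fin 2) (Af K)} (hk : k ∈ maxCompact K)
    (v : HeightOneSpectrum (𝓞 K)) : rowNorm (g * k) v ≤ rowNorm g v := by
  have hk' := norm_apply_le_one_of_mem_maxCompact hk
  refine max_le ?_ ?_ <;> rw [GL_Af_mul_apply] <;>
  refine (IsUltrametricDist.norm_add_le_max _ _).trans (max_le_max ?_ ?_) <;> rw [norm_mul] <;>
  exact mul_le_of_le_one_right (norm_nonneg _) (hk' _ _ v)

theorem finHeight_mul (g : GL (Fin 2) (Af K)) {k : GL (Fin 2) (Af K)} (hk : k ∈ maxCompact K) :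
    finHeight (g * k) = finHeight g := by
  -- Right multiplication by an integral matrix cannot increase the row norm; applying this to `k`
  -- and to `k⁻¹` gives equality.
  have h : ∀ v, rowNorm (g * k) v = rowNorm g v := fun v => by
    refine le_antisymm (rowNorm_mul_le g hk v) ?_
    have := rowNorm_mul_le (g * k) (maxCompact_inv hk) v
    rwa [mul_inv_cancel_right] at this
  have hdet : finNorm (k.det : Af K) = 1 := finNorm_eq_one (norm_det_of_mem_maxCompact hk)
  rw [finHeight_def, finHeight_def, finprod_congr h, map_mul, finNorm_mul, hdet, mul_one]

theorem finHeight_eq_one {k : GL (Fin 2) (Af K)} (hk : k ∈ maxCompact K) : finHeight k = 1 := by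
  have hdet : finNorm (k.det : Af K) = 1 := finNorm_eq_one (norm_det_of_mem_maxCompact hk)
  have hrow : ∀ v, rowNorm k v = 1 := fun v =>
    rowNorm_eq_one (fun i j => norm_apply_le_one_of_mem_maxCompact hk i j v)
      (norm_det_of_mem_maxCompact hk v)
  rw [finHeight_def, hdet, finprod_eq_one_of_forall_eq_one hrow]
  norm_num

/-! ## Induced spaces -/

variable {σ : K →+* ℂ} {φ₁ φ₂ : HeckeCharacter σ}

theorem flatSection_apply_of_mem_maxCompact (Ψ : GL (Fin 2) (Af K) → ℂ) (s : ℂ)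
    {k : GL (Fin 2) (Af K)} (hk : k ∈ maxCompact K) : flatSection Ψ s k = Ψ k := by
  rw [flatSection, finHeight_eq_one hk, Complex.ofReal_one, Complex.one_cpow, mul_one]

theorem flatSection_mem {Ψ : GL (Fin 2) (Af K) → ℂ} (hΨ : Ψ ∈ inducedSpace φ₁ φ₂ 0) (s : ℂ) :
    flatSection Ψ s ∈ inducedSpace φ₁ φ₂ s := by
  obtain ⟨h1, h2⟩ := hΨ
  refine ⟨fun a d x g => ?_, fun g k hk => ?_⟩
  · rw [flatSection, flatSection, h1, finHeight_upper_mul, Complex.ofReal_mul,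
      Complex.mul_cpow_ofReal_nonneg (finNorm_pos _).le (finHeight_pos g).le, zero_div,
      Complex.cpow_zero]
    ring
  · rw [flatSection, flatSection, h2 g k hk, finHeight_mul g hk.1]

/-- Elements of `GL₂(𝓞̂)` of determinant one act trivially from the left on the values at
`GL₂(𝓞̂)`. -/
theorem apply_mul_of_det_eq_one {s : ℂ} {Ψ : GL (Fin 2) (Af K) → ℂ}
    (hΨ : Ψ ∈ inducedSpace φ₁ φ₂ s) {δ k : GL (Fin 2) (Af K)} (hδ : δ ∈ maxCompact K)
    (hdet : δ.det = 1) (hk : k ∈ maxCompact K) : Ψ (δ * k) = Ψ k := by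
  -- Write `δ k = k (k⁻¹ δ k)`: the conjugate is integral of determinant one, hence in the level
  -- group, and right invariance applies.
  have hmem : k⁻¹ * δ * k ∈ level φ₁ := by
    refine ⟨maxCompact_mul (maxCompact_mul (maxCompact_inv hk) hδ) hk, fun v => ?_⟩
    have : (k⁻¹ * δ * k).det = 1 := by
      rw [map_mul, map_mul, hdet, mul_one, map_inv, inv_mul_cancel]
    have h2 : ((k⁻¹ * δ * k : GL (Fin 2) (Af K)) : Matrix (Fin 2) (Fin 2) (Af K)).det = 1 :=
      congrArg Units.val this
    rw [h2, Af_one_apply, sub_self, map_zero]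
    exact zero_le
  have := hΨ.2 k _ hmem
  rw [← this, ← mul_assoc, ← mul_assoc, mul_inv_cancel, one_mul]

theorem infPart_mul_finPart (φ : HeckeCharacter σ) (x : Kˣ) :
    φ.infPart (Units.map (σ : K →* ℂ) x) *
      φ.finPart (Units.map (algebraMap K (Af K) : K →* Af K) x) = 1 := by
  have h := φ.map_principal x
  have h2 : principal σ x = (Units.map (σ : K →* ℂ) x, 1) *
      (1, Units.map (algebraMap K (Af K) : K →* Af K) x) := by
    simp [principal, MonoidHom.prod_apply]
  rw [h2, map_mul] at h
  have := congrArg Units.val h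
  simpa [HeckeCharacter.infPart, HeckeCharacter.finPart] using this

end Adelic

/-! ## Equivariance -/

theorem pullback_vsdz_upper {b : Matrix (Fin 2) (Fin 2) ℂ} (h : b 1 0 = 0) (hb : b.det ≠ 0)
    (s : ℂ) {u : ℂ × ℝ} (hu : 0 < u.2) :
    pullback b (vsdz s) u =
      ((‖b 0 0 / b 1 1‖ : ℂ) ^ s * (b 0 0 / b 1 1)) • vsdz s u := by
  refine ContinuousLinearMap.ext fun ξ => ?_
  rw [pullback, ContinuousLinearMap.comp_apply, fderiv_act_upper h hb, act_upper h hb]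
  simp only [vsdz, smul_apply, ContinuousLinearMap.coe_fst', smul_eq_mul, Complex.ofReal_mul,
    Complex.mul_cpow_ofReal_nonneg (norm_nonneg _) hu.le]
  ring

/-- Used with `q` a finite norm and `r` a complex modulus: the product formula involves `r²`, and `r
^ s = (r²) ^ (s / 2)`. -/
theorem ofReal_cpow_half_mul_cpow {q r : ℝ} (hq : 0 < q) (hr : 0 < r) (h : q * r ^ 2 = 1) (s : ℂ) :
    (q : ℂ) ^ (s / 2) * (r : ℂ) ^ s = 1 := by
  have hr0 : (r : ℂ) ≠ 0 := by exact_mod_cast hr.ne'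
  have h1 : (r : ℂ) ^ s = ((r * r : ℝ) : ℂ) ^ (s / 2) := by
    rw [Complex.ofReal_mul, Complex.mul_cpow_ofReal_nonneg hr.le hr.le,
      ← Complex.cpow_add _ _ hr0, add_halves]
  rw [h1, ← Complex.mul_cpow_ofReal_nonneg hq.le (by positivity), ← Complex.ofReal_mul, ← pow_two,
    h, Complex.ofReal_one, Complex.one_cpow]

section

variable {K : Type*} [Field K] [NumberField K]

theorem omegaTilde_eq_pullback_basePt (Ψ : GL (Fin 2) (Af K) → ℂ) (s : ℂ) (X : 𝔭) (g : GA K) :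
    omegaTilde Ψ s X g = 1 / 2 * Ψ g.2 *
      pullback (g.1 : Matrix (Fin 2) (Fin 2) ℂ) (vsdz s) basePt (tangentEquiv X) := by
  obtain ⟨a, d, x, k, hi⟩ := exists_isIwasawa g.1
  rw [omegaTilde_eq Ψ s X g hi, mul_right_comm, hi.cpow_mul_Scheck]
  ring

theorem omegaTilde_mul_right {σ : K →+* ℂ} {φ₁ φ₂ : HeckeCharacter σ} {s : ℂ}
    {Ψ : GL (Fin 2) (Af K) → ℂ} (hΨ : Ψ ∈ inducedSpace φ₁ φ₂ s) (X : Matrix (Fin 2) (Fin 2) ℂ)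
    {k : GL (Fin 2) ℂ} (hk : k ∈ Kinf) {k' : GL (Fin 2) (Af K)} (hk' : k' ∈ level φ₁) (g : GA K) :
    omegaTilde Ψ s X (g * (k, k')) = omegaTilde Ψ s (Ad k X) g := by
  obtain ⟨a, d, x, k₀, hi⟩ := exists_isIwasawa g.1
  have hi' : IsIwasawa (g * (k, k')).1 a d x (k₀ * k) := by
    obtain ⟨ha, hd, hk₀, hg⟩ := hi
    refine ⟨ha, hd, Kinf_mul hk₀ hk, ?_⟩
    rw [Prod.fst_mul, Units.val_mul, hg, Units.val_mul, Matrix.mul_assoc]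
  rw [omegaTilde_eq Ψ s X _ hi', omegaTilde_eq Ψ s _ g hi, Ad_mul, Prod.snd_mul, hΨ.2 _ _ hk']

/-- Two factors cancel separately: `φ₁(a) φ₂(d)` at the finite places against `a / d` from `dz`, and
`|a/d|_f^{s/2}` against `‖σ(a/d)‖^s` from the height. -/
theorem omegaTilde_rational_mul [NumberField.IsTotallyComplex K] (hdeg : Module.finrank ℚ K = 2)
    {σ : K →+* ℂ} {φ₁ φ₂ : HeckeCharacter σ}
    (h₁ : ∀ z : ℂˣ, φ₁.infPart z = (z : ℂ)) (h₂ : ∀ z : ℂˣ, φ₂.infPart z = (z : ℂ)⁻¹) {s : ℂ}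
    {Ψ : GL (Fin 2) (Af K) → ℂ} (hΨ : Ψ ∈ inducedSpace φ₁ φ₂ s) {X : Matrix (Fin 2) (Fin 2) ℂ}
    (hX : X ∈ 𝔭) {γ : GL (Fin 2) K} (hγ : γ ∈ borel K) (g : GA K) :
    omegaTilde Ψ s X (rational σ γ * g) = omegaTilde Ψ s X g := by
  have hγ : γ 1 0 = 0 := hγ
  have hdet : γ 0 0 * γ 1 1 ≠ 0 := by
    have := γ.det.ne_zero
    rwa [Matrix.GeneralLinearGroup.val_det_apply, Matrix.det_fin_two, hγ, mul_zero,
      sub_zero] at this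
  have ha := left_ne_zero_of_mul hdet
  have hd := right_ne_zero_of_mul hdet
  set a : Kˣ := Units.mk0 _ ha with ha_def
  set d : Kˣ := Units.mk0 _ hd with hd_def
  have hf : (rational σ γ).2 = upper (Units.map (algebraMap K (Af K) : K →* Af K) a)
      (Units.map (algebraMap K (Af K) : K →* Af K) d) (algebraMap K (Af K) (γ 0 1)) := by
    refine Units.ext (Matrix.ext fun i j => ?_)
    fin_cases i <;> fin_cases j
    · rfl
    · rfl
    · exact (congrArg (algebraMap K (Af K)) hγ).trans (map_zero _)
    · rfl
  have hinf : ∀ i j, ((rational σ γ).1 : Matrix (Fin 2) (Fin 2) ℂ) i j = σ (γ i j) :=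
    fun _ _ => rfl
  have hdetC := GL_det_ne_zero (rational σ γ).1
  have h10 : ((rational σ γ).1 : Matrix (Fin 2) (Fin 2) ℂ) 1 0 = 0 := by
    rw [hinf, hγ, map_zero]
  have hp : (finNorm ((Units.map (algebraMap K (Af K) : K →* Af K) a /
      Units.map (algebraMap K (Af K) : K →* Af K) d : (Af K)ˣ) : Af K)) *
      ‖σ (γ 0 0) / σ (γ 1 1)‖ ^ 2 = 1 := by
    have e := finNorm_mul_norm_sq hdeg σ (div_ne_zero ha hd)
    rw [map_div₀ σ] at e
    rw [← e, ← map_div]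
    congr 2
    change algebraMap K (Af K) ((a / d : Kˣ) : K) = _
    rw [Units.val_div_eq_div_val]
    rfl
  have hσa : σ (γ 0 0) ≠ 0 := (map_ne_zero σ).2 ha
  have hσd : σ (γ 1 1) ≠ 0 := (map_ne_zero σ).2 hd
  have hcp := ofReal_cpow_half_mul_cpow (finNorm_pos _)
    (norm_pos_iff.2 (div_ne_zero hσa hσd)) hp s
  have e1 := infPart_mul_finPart φ₁ a
  have e2 := infPart_mul_finPart φ₂ d
  rw [h₁] at e1
  rw [h₂] at e2
  have e1' : σ (γ 0 0) * φ₁.finPart (Units.map (algebraMap K (Af K) : K →* Af K) a) = 1 := e1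
  have e2' : (σ (γ 1 1))⁻¹ * φ₂.finPart (Units.map (algebraMap K (Af K) : K →* Af K) d) = 1 := e2
  have hpull : pullback (((rational σ γ * g).1 : GL (Fin 2) ℂ) : Matrix (Fin 2) (Fin 2) ℂ)
      (vsdz s) basePt = ((‖σ (γ 0 0) / σ (γ 1 1)‖ : ℂ) ^ s * (σ (γ 0 0) / σ (γ 1 1))) •
        pullback (g.1 : Matrix (Fin 2) (Fin 2) ℂ) (vsdz s) basePt := by
    rw [Prod.fst_mul, Units.val_mul, pullback_mul hdetC (GL_det_ne_zero _) _ basePt_snd_pos,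
      pullback_vsdz_upper h10 hdetC s (act_snd_pos (GL_det_ne_zero _) basePt_snd_pos),
      hinf, hinf]
    rfl
  have l := omegaTilde_eq_pullback_basePt Ψ s ⟨X, hX⟩ (rational σ γ * g)
  have r := omegaTilde_eq_pullback_basePt Ψ s ⟨X, hX⟩ g
  rw [l, r, hpull, Prod.snd_mul, hf, hΨ.1, smul_apply, smul_eq_mul]
  set A := φ₁.finPart (Units.map (algebraMap K (Af K) : K →* Af K) a)
  set D := φ₂.finPart (Units.map (algebraMap K (Af K) : K →* Af K) d)
  have e3 : A * D * (σ (γ 0 0) / σ (γ 1 1)) = 1 := by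
    linear_combination ((σ (γ 1 1))⁻¹ * D) * e1' + e2'
  linear_combination (1 / 2 * Ψ g.2 * pullback (g.1 : Matrix (Fin 2) (Fin 2) ℂ) (vsdz s) basePt
    (tangentEquiv ⟨X, hX⟩)) * (A * D * (σ (γ 0 0) / σ (γ 1 1)) * hcp + e3)

end

/-! ## Convergence -/

section Convergence

variable {K : Type*} [Field K] [NumberField K] (σ : K →+* ℂ)

theorem det_slMatrix (γ : Matrix.SpecialLinearGroup (Fin 2) (𝓞 K)) : (slMatrix σ γ).det = 1 := by
  have h := γ.det_coe
  rw [Matrix.det_fin_two] at h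
  have h' := congrArg (fun x : 𝓞 K => σ (x : K)) h
  simp only [map_sub, map_mul, map_one] at h'
  rw [Matrix.det_fin_two]
  exact h'

theorem det_slMatrix_ne_zero (γ : Matrix.SpecialLinearGroup (Fin 2) (𝓞 K)) :
    (slMatrix σ γ).det ≠ 0 := by
  rw [det_slMatrix]
  exact one_ne_zero

theorem slMatrix_mul (γ δ : Matrix.SpecialLinearGroup (Fin 2) (𝓞 K)) :
    slMatrix σ (γ * δ) = slMatrix σ γ * slMatrix σ δ :=
  Matrix.map_mul (f := σ.comp (algebraMap (𝓞 K) K))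

/-- All finite absolute values of an integer are at most one, so the product formula pushes the
complex one up to at least one. -/
theorem one_le_norm_of_integer [NumberField.IsTotallyComplex K] (hdeg : Module.finrank ℚ K = 2)
    {x : 𝓞 K} (hx : x ≠ 0) : 1 ≤ ‖σ (x : K)‖ := by
  have hx' : (x : K) ≠ 0 := by simpa using hx
  have h := finNorm_mul_norm_sq hdeg σ hx'
  have hle : finNorm (algebraMap K (Af K) (x : K)) ≤ 1 :=
    finprod_induction (fun y : ℝ => 0 ≤ y ∧ y ≤ 1) ⟨zero_le_one, le_rfl⟩
      (fun a b ha hb => ⟨mul_nonneg ha.1 hb.1, mul_le_one₀ ha.2 hb.1 hb.2⟩)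
      (fun v => ⟨norm_nonneg _, NumberField.FinitePlace.norm_le_one K v x⟩) |>.2
  by_contra! hlt
  have h0 : 0 ≤ ‖σ (x : K)‖ := norm_nonneg _
  have h1 : ‖σ (x : K)‖ ^ 2 < 1 := by nlinarith
  nlinarith [sq_nonneg ‖σ (x : K)‖]

/-- The embedding of `𝓞²` into `ℂ²`. -/
def pairEmbedding : 𝓞 K × 𝓞 K →ₗ[ℤ] ℂ × ℂ :=
  let f : 𝓞 K →ₗ[ℤ] ℂ := (σ.comp (algebraMap (𝓞 K) K)).toAddMonoidHom.toIntLinearMap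
  f.prodMap f

theorem pairEmbedding_apply (x : 𝓞 K × 𝓞 K) :
    pairEmbedding σ x = (σ (x.1 : K), σ (x.2 : K)) := rfl

theorem pairEmbedding_injective : Function.Injective (pairEmbedding σ) := by
  intro x y h
  rw [pairEmbedding_apply, pairEmbedding_apply, Prod.mk.injEq] at h
  exact Prod.ext (NumberField.RingOfIntegers.ext (σ.injective h.1))
    (NumberField.RingOfIntegers.ext (σ.injective h.2))

theorem one_le_norm_pairEmbedding [NumberField.IsTotallyComplex K]
    (hdeg : Module.finrank ℚ K = 2) {x : 𝓞 K × 𝓞 K} (hx : x ≠ 0) : 1 ≤ ‖pairEmbedding σ x‖ := by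
  by_cases h : x.1 = 0
  · have h2 : x.2 ≠ 0 := fun h2 => hx (Prod.ext h h2)
    exact (one_le_norm_of_integer σ hdeg h2).trans (norm_snd_le (pairEmbedding σ x))
  · exact (one_le_norm_of_integer σ hdeg h).trans (norm_fst_le (pairEmbedding σ x))

/-- Distinct points of the image of `𝓞²` are at distance at least one, so it is a discrete subgroup
of `ℂ²`. Its rank is `2 · 2 = 4`, whence the bound on the exponent. -/
theorem summable_norm_pairEmbedding [NumberField.IsTotallyComplex K]
    (hdeg : Module.finrank ℚ K = 2) {r : ℝ} (hr : r < -4) :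
    Summable fun x : 𝓞 K × 𝓞 K => ‖pairEmbedding σ x‖ ^ r := by
  set L : Submodule ℤ (ℂ × ℂ) := LinearMap.range (pairEmbedding σ) with hL
  let e : (𝓞 K × 𝓞 K) ≃ₗ[ℤ] L := LinearEquiv.ofInjective _ (pairEmbedding_injective σ)
  have hdisc : DiscreteTopology L := by
    refine DiscreteTopology.of_forall_le_dist one_pos ?_
    intro x y hxy
    obtain ⟨a, rfl⟩ := e.surjective x
    obtain ⟨b, rfl⟩ := e.surjective y
    have hab : a - b ≠ 0 := sub_ne_zero.2 fun h => hxy (by rw [h])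
    have := one_le_norm_pairEmbedding σ hdeg hab
    rw [map_sub] at this
    rw [Subtype.dist_eq, dist_eq_norm]
    exact this
  have hfin : Module.finrank ℤ L = 4 := by
    rw [← e.finrank_eq, Module.finrank_prod, NumberField.RingOfIntegers.rank, hdeg]
  have h := ZLattice.summable_norm_rpow L r (by rw [hfin]; exact_mod_cast hr)
  exact (e.toEquiv.summable_iff (f := fun z : L => ‖z‖ ^ r)).2 h

/-- The bottom row of a matrix in `SL₂(𝓞)`. -/
def bottomRow (γ : Matrix.SpecialLinearGroup (Fin 2) (𝓞 K)) : 𝓞 K × 𝓞 K := (γ 1 0, γ 1 1)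

theorem bottomRow_ne_zero (γ : Matrix.SpecialLinearGroup (Fin 2) (𝓞 K)) : bottomRow γ ≠ 0 := by
  intro h
  have h0 : γ 1 0 = 0 := congrArg Prod.fst h
  have h1 : γ 1 1 = 0 := congrArg Prod.snd h
  have hd := γ.det_coe
  rw [Matrix.det_fin_two, h0, h1] at hd
  simp at hd

theorem SL2_mul_inv_apply {R : Type*} [CommRing R] (δ γ : Matrix.SpecialLinearGroup (Fin 2) R) :
    (δ * γ⁻¹) 0 0 = δ 0 0 * γ 1 1 - δ 0 1 * γ 1 0 ∧
    (δ * γ⁻¹) 1 0 = δ 1 0 * γ 1 1 - δ 1 1 * γ 1 0 ∧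
    (δ * γ⁻¹) 1 1 = δ 1 1 * γ 0 0 - δ 1 0 * γ 0 1 := by
  rw [Matrix.SpecialLinearGroup.coe_mul, Matrix.SpecialLinearGroup.coe_inv,
    Matrix.adjugate_fin_two]
  simp only [Matrix.mul_apply, Fin.sum_univ_two, Matrix.of_apply, Matrix.cons_val',
    Matrix.cons_val_zero, Matrix.cons_val_one, Matrix.cons_val_fin_one]
  refine ⟨?_, ?_, ?_⟩ <;> ring

/-- Two matrices of determinant one with the same bottom row differ by a unipotent upper triangular
matrix on the left. -/
theorem bottomRow_out_injective :
    Function.Injective fun q : Quotient (QuotientGroup.rightRel (unipInfty K)) =>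
      bottomRow q.out := by
  intro q q' h
  simp only [bottomRow, Prod.mk.injEq] at h
  obtain ⟨h0, h1⟩ := h
  rw [← Quotient.out_equiv_out]
  refine QuotientGroup.rightRel_apply.2 ?_
  have hd := q.out.det_coe
  have hd' := q'.out.det_coe
  rw [Matrix.det_fin_two] at hd hd'
  obtain ⟨e00, e10, e11⟩ := SL2_mul_inv_apply q'.out q.out
  refine ⟨?_, ?_, ?_⟩
  · rw [e00, h0, h1]
    exact hd'
  · rw [e10, h0, h1]
    ring
  · rw [e11, ← h0, ← h1, mul_comm, mul_comm (q.out 1 0)]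
    exact hd

/-- For `v > 0` the linear map `(c, d) ↦ (c z + d, c v)` is invertible, so the size of `(c, d)` is
controlled by the automorphy factor, uniformly in `γ`. -/
theorem exists_norm_le_actDenom {u : ℂ × ℝ} (hu : 0 < u.2) : ∃ M : ℝ, 0 < M ∧
    ∀ γ : Matrix.SpecialLinearGroup (Fin 2) (𝓞 K),
      ‖pairEmbedding σ (bottomRow γ)‖ ^ 2 ≤ M * actDenom (slMatrix σ γ) u := by
  -- With `D` the root of the automorphy factor, `‖c‖ ≤ D / v` and `‖d‖ ≤ D (1 + ‖z‖ / v)`; `M` is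
  -- the sum of the two constants.
  set M : ℝ := 1 / u.2 + (1 + ‖u.1‖ / u.2)
  have hM : 0 < M := by positivity
  refine ⟨M ^ 2, by positivity, fun γ => ?_⟩
  set c : ℂ := slMatrix σ γ 1 0 with hc
  set d : ℂ := slMatrix σ γ 1 1 with hd
  set D : ℝ := √(actDenom (slMatrix σ γ) u) with hD
  have hden : actDenom (slMatrix σ γ) u = ‖c * u.1 + d‖ ^ 2 + ‖c‖ ^ 2 * u.2 ^ 2 := rfl
  have hD0 : 0 ≤ D := Real.sqrt_nonneg _
  have h1 : ‖c * u.1 + d‖ ≤ D := by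
    apply Real.le_sqrt_of_sq_le
    rw [hden]
    have : 0 ≤ ‖c‖ ^ 2 * u.2 ^ 2 := by positivity
    linarith
  have h2 : ‖c‖ * u.2 ≤ D := by
    apply Real.le_sqrt_of_sq_le
    rw [hden, mul_pow]
    have : 0 ≤ ‖c * u.1 + d‖ ^ 2 := by positivity
    linarith
  have h3 : ‖c‖ ≤ D / u.2 := (le_div_iff₀ hu).2 h2
  have h4 : ‖d‖ ≤ D + D / u.2 * ‖u.1‖ := by
    calc ‖d‖ = ‖(c * u.1 + d) - c * u.1‖ := by ring_nf
      _ ≤ ‖c * u.1 + d‖ + ‖c‖ * ‖u.1‖ := (norm_sub_le _ _).trans (by rw [norm_mul])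
      _ ≤ _ := by gcongr
  have h5 : ‖pairEmbedding σ (bottomRow γ)‖ ≤ M * D := by
    change max ‖c‖ ‖d‖ ≤ M * D
    have e : M * D = D / u.2 + (D + D / u.2 * ‖u.1‖) := by
      simp only [M]
      ring
    have p1 : 0 ≤ D / u.2 := by positivity
    have p2 : 0 ≤ D / u.2 * ‖u.1‖ := by positivity
    rw [e]
    exact max_le (by linarith) (by linarith)
  calc ‖pairEmbedding σ (bottomRow γ)‖ ^ 2 ≤ (M * D) ^ 2 := by gcongr
    _ = M ^ 2 * actDenom (slMatrix σ γ) u := by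
      rw [mul_pow, hD, Real.sq_sqrt]
      rw [hden]; positivity

theorem summable_classicalTerm_unipInfty [NumberField.IsTotallyComplex K]
    (hdeg : Module.finrank ℚ K = 2) {s : ℂ} (hs : 1 < s.re) {u : ℂ × ℝ} (hu : 0 < u.2) :
    Summable (classicalTerm σ (unipInfty K) s u) := by
  obtain ⟨C, hC⟩ := exists_norm_pullback_le hu s
  obtain ⟨M, hM, hbound⟩ := exists_norm_le_actDenom σ hu
  -- The height decays like `‖(c, d)‖⁻²`, and `-2 (1 + Re s) < -4` is exactly `Re s > 1`.
  have hsum := ((summable_norm_pairEmbedding σ hdeg (r := -2 * (1 + s.re))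
    (by linarith)).comp_injective bottomRow_out_injective).mul_left (|C| * (u.2 * M) ^ (1 + s.re))
  refine hsum.of_norm_bounded fun q => ?_
  have hdet := det_slMatrix_ne_zero σ q.out
  have h1 := hC (Matrix.GeneralLinearGroup.mkOfDetNeZero _ hdet)
  change ‖classicalTerm σ (unipInfty K) s u q‖ ≤ C * (act (slMatrix σ q.out) u).2 ^ _ at h1
  have hn : 0 < ‖pairEmbedding σ (bottomRow q.out)‖ :=
    one_pos.trans_le (one_le_norm_pairEmbedding σ hdeg (bottomRow_ne_zero _))
  have hden := actDenom_pos hdet hu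
  have h2 : (act (slMatrix σ q.out) u).2 ≤
      u.2 * M * (‖pairEmbedding σ (bottomRow q.out)‖ ^ 2)⁻¹ := by
    rw [act_snd, det_slMatrix, norm_one, one_mul, div_le_iff₀ hden, mul_assoc, mul_assoc]
    refine le_mul_of_one_le_right hu.le ?_
    rw [mul_left_comm, ← div_eq_inv_mul, one_le_div (by positivity)]
    exact hbound _
  have hpos := act_snd_pos hdet hu
  refine h1.trans ?_
  calc C * (act (slMatrix σ q.out) u).2 ^ (1 + s.re)
      ≤ |C| * (u.2 * M * (‖pairEmbedding σ (bottomRow q.out)‖ ^ 2)⁻¹) ^ (1 + s.re) := by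
        refine mul_le_mul (le_abs_self C) (Real.rpow_le_rpow hpos.le h2 (by linarith))
          (by positivity) (abs_nonneg C)
    _ = _ := by
        rw [Real.mul_rpow (by positivity) (by positivity), mul_assoc]
        congr 2
        simp only [Function.comp_apply]
        rw [neg_mul, Real.rpow_neg (norm_nonneg _), Real.inv_rpow (by positivity),
          Real.rpow_mul (norm_nonneg _)]
        norm_num

end Convergence

section Comparison

variable {K : Type*} [Field K] [NumberField K] {σ : K →+* ℂ}

/-! ## Units -/

/-- A global unit is a local unit at each finite place, so the finite part of `χ` is trivial on it;
triviality of `χ` on `Kˣ` then leaves `σ(ε)² = 1`. -/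
theorem sq_eq_one_of_isUnramified {χ : HeckeCharacter σ} (hunr : χ.IsUnramified)
    (hχinf : ∀ z : ℂˣ, χ.infPart z = (z : ℂ) ^ 2) (ε : (𝓞 K)ˣ) : (ε : 𝓞 K) ^ 2 = 1 := by
  have h := infPart_mul_finPart χ (Units.map (algebraMap (𝓞 K) K : 𝓞 K →* K) ε)
  have hle : ∀ (y : 𝓞 K) (v : HeightOneSpectrum (𝓞 K)),
      ‖algebraMap K (Af K) (y : K) v‖ ≤ 1 := fun y v =>
    NumberField.FinitePlace.norm_le_one K v y
  rw [hunr, mul_one, hχinf] at h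
  · have h' : σ (((ε : 𝓞 K) ^ 2 : 𝓞 K) : K) = 1 := by
      rw [NumberField.RingOfIntegers.coe_eq_algebraMap, map_pow, map_pow]
      exact h
    refine NumberField.RingOfIntegers.ext (σ.injective (h'.trans ?_))
    rw [NumberField.RingOfIntegers.coe_eq_algebraMap, map_one, map_one]
  · intro v
    refine Af_norm_eq_one_iff.1 (le_antisymm (hle _ v) ?_)
    have hmul : ‖algebraMap K (Af K) ((ε : 𝓞 K) : K) v‖ *
        ‖algebraMap K (Af K) (((ε⁻¹ : (𝓞 K)ˣ) : 𝓞 K) : K) v‖ = 1 := by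
      rw [← norm_mul, ← Af_mul_apply, ← map_mul, ← map_mul, Units.mul_inv, map_one, map_one,
        Af_one_apply, norm_one]
    -- The norms of `ε` and `ε⁻¹` are at most one and have product one.
    change 1 ≤ ‖algebraMap K (Af K) ((ε : 𝓞 K) : K) v‖
    nlinarith [hle (ε : 𝓞 K) v, hle ((ε⁻¹ : (𝓞 K)ˣ) : 𝓞 K) v,
      norm_nonneg (algebraMap K (Af K) ((ε : 𝓞 K) : K) v)]

/-- The diagonal entries of an element of `Γ_∞` are both `1` or both `-1` when all units have
square one. -/
theorem diag_of_mem_stabInfty (hO : ∀ ε : (𝓞 K)ˣ, (ε : 𝓞 K) ^ 2 = 1)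
    {γ : Matrix.SpecialLinearGroup (Fin 2) (𝓞 K)} (hγ : γ ∈ stabInfty K) :
    (γ 0 0 = 1 ∧ γ 1 1 = 1) ∨ (γ 0 0 = -1 ∧ γ 1 1 = -1) := by
  have hγ : γ 1 0 = 0 := hγ
  have hd := γ.det_coe
  rw [Matrix.det_fin_two, hγ, mul_zero, sub_zero] at hd
  have h2 := hO (Units.mkOfMulEqOne _ _ hd)
  rw [Units.val_mkOfMulEqOne, sq_eq_one_iff] at h2
  rcases h2 with h | h
  · left
    refine ⟨h, ?_⟩
    rw [h, one_mul] at hd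
    exact hd
  · right
    refine ⟨h, ?_⟩
    rw [h] at hd
    linear_combination -hd

theorem pullback_stabInfty (hO : ∀ ε : (𝓞 K)ˣ, (ε : 𝓞 K) ^ 2 = 1) (s : ℂ)
    {γ : Matrix.SpecialLinearGroup (Fin 2) (𝓞 K)} (hγ : γ ∈ stabInfty K) {u : ℂ × ℝ}
    (hu : 0 < u.2) : pullback (slMatrix σ γ) (vsdz s) u = vsdz s u := by
  have h10 : slMatrix σ γ 1 0 = 0 := by
    have hγ : γ 1 0 = 0 := hγ
    simp [slMatrix, hγ]
  have hq : slMatrix σ γ 0 0 / slMatrix σ γ 1 1 = 1 := by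
    rcases diag_of_mem_stabInfty hO hγ with ⟨h, h'⟩ | ⟨h, h'⟩ <;> simp [slMatrix, h, h']
  rw [pullback_vsdz_upper h10 (det_slMatrix_ne_zero σ γ) s hu, hq]
  simp

theorem unipInfty_le_stabInfty : unipInfty K ≤ stabInfty K := fun _ h => h.2.1

/-! ## Sums over cosets -/

/-- The series are summed over the representatives `Quotient.out`; left invariance makes that choice
immaterial. -/
theorem apply_out_rightRel {G E : Type*} [Group G] {H : Subgroup G} {f : G → E}
    (hf : ∀ h ∈ H, ∀ g, f (h * g) = f g) (g : G) :
    f (Quotient.mk (QuotientGroup.rightRel H) g).out = f g := by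
  have h : (QuotientGroup.rightRel H) (Quotient.mk (QuotientGroup.rightRel H) g).out g :=
    Quotient.mk_out g
  have := hf _ (QuotientGroup.rightRel_apply.1 h) (Quotient.mk (QuotientGroup.rightRel H) g).out
  rw [inv_mul_cancel_right] at this
  exact this.symm

theorem pullback_slMatrix_mul (hO : ∀ ε : (𝓞 K)ˣ, (ε : 𝓞 K) ^ 2 = 1) (s : ℂ) {u : ℂ × ℝ}
    (hu : 0 < u.2) {β : Matrix.SpecialLinearGroup (Fin 2) (𝓞 K)} (hβ : β ∈ stabInfty K)
    (γ : Matrix.SpecialLinearGroup (Fin 2) (𝓞 K)) :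
    pullback (slMatrix σ (β * γ)) (vsdz s) u = pullback (slMatrix σ γ) (vsdz s) u := by
  rw [slMatrix_mul]
  exact pullback_mul_of_invariant (det_slMatrix_ne_zero σ β) (det_slMatrix_ne_zero σ γ) _
    (fun u hu => pullback_stabInfty hO s hβ hu) hu

theorem neg_mul_inv_mem_stabInfty (γ : Matrix.SpecialLinearGroup (Fin 2) (𝓞 K)) :
    -γ * γ⁻¹ ∈ stabInfty K := by
  rw [neg_mul, mul_inv_cancel]
  change (-(1 : Matrix (Fin 2) (Fin 2) (𝓞 K))) 1 0 = 0
  simp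

variable (K) in
/-- The two lifts of a class in `Γ_∞ \ Γ` to `N_∞ \ Γ`. -/
def liftClass : Quotient (QuotientGroup.rightRel (stabInfty K)) ⊕
    Quotient (QuotientGroup.rightRel (stabInfty K)) →
      Quotient (QuotientGroup.rightRel (unipInfty K)) :=
  Sum.elim (fun q => Quotient.mk _ q.out) (fun q => Quotient.mk _ (-q.out))

theorem neg_one_notMem_unipInfty : (-1 : Matrix.SpecialLinearGroup (Fin 2) (𝓞 K)) ∉ unipInfty K := by
  rintro ⟨h, -⟩
  have h' : (-1 : 𝓞 K) = 1 := by
    simpa using h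
  have : (2 : 𝓞 K) = 0 := by linear_combination -h'
  exact two_ne_zero this

theorem liftClass_injective : Function.Injective (liftClass K) := by
  have key : ∀ q q' : Quotient (QuotientGroup.rightRel (stabInfty K)),
      q'.out * q.out⁻¹ ∈ stabInfty K → q = q' := fun q q' h => by
    rw [← Quotient.out_equiv_out]
    exact QuotientGroup.rightRel_apply.2 h
  have hneg : ∀ β, -β ∈ unipInfty K → β ∈ stabInfty K := fun β hβ => by
    have h : (-β) 1 0 = 0 := hβ.2.1
    rw [Matrix.SpecialLinearGroup.coe_neg, Matrix.neg_apply, neg_eq_zero] at h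
    exact h
  rintro (q | q) (q' | q') h
  · have h := QuotientGroup.rightRel_apply.1 (Quotient.exact h)
    rw [key q q' (unipInfty_le_stabInfty h)]
  -- A coincidence between the two sheets forces `q = q'` and then `-1 ∈ N_∞`, which is impossible
  -- in characteristic zero.
  · have h := QuotientGroup.rightRel_apply.1 (Quotient.exact h)
    rw [neg_mul] at h
    have e := key q q' (hneg _ h)
    rw [e, mul_inv_cancel] at h
    exact absurd h neg_one_notMem_unipInfty
  · have h := QuotientGroup.rightRel_apply.1 (Quotient.exact h)
    rw [inv_neg, mul_neg] at h
    have e := key q q' (hneg _ h)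
    rw [e, mul_inv_cancel] at h
    exact absurd h neg_one_notMem_unipInfty
  · have h := QuotientGroup.rightRel_apply.1 (Quotient.exact h)
    rw [inv_neg, neg_mul_neg] at h
    rw [key q q' (unipInfty_le_stabInfty h)]

/-- This is `Γ_∞ = N_∞ ∪ -N_∞`, where the condition on units enters. -/
theorem liftClass_surjective (hO : ∀ ε : (𝓞 K)ˣ, (ε : 𝓞 K) ^ 2 = 1) :
    Function.Surjective (liftClass K) := by
  intro p
  induction p using Quotient.inductionOn with | _ γ
  set q := Quotient.mk (QuotientGroup.rightRel (stabInfty K)) γ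
  have h : γ * q.out⁻¹ ∈ stabInfty K := QuotientGroup.rightRel_apply.1 (Quotient.mk_out γ)
  rcases diag_of_mem_stabInfty hO h with h' | h'
  · exact ⟨Sum.inl q, Quotient.sound (QuotientGroup.rightRel_apply.2 ⟨h'.1, h, h'.2⟩)⟩
  · refine ⟨Sum.inr q, Quotient.sound (QuotientGroup.rightRel_apply.2 ?_)⟩
    rw [inv_neg, mul_neg]
    have h0 : (γ * q.out⁻¹) 1 0 = 0 := h
    refine ⟨?_, ?_, ?_⟩ <;> rw [Matrix.SpecialLinearGroup.coe_neg, Matrix.neg_apply]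
    · rw [h'.1, neg_neg]
    · rw [h0, neg_zero]
    · rw [h'.2, neg_neg]

theorem classicalTerm_inl (hO : ∀ ε : (𝓞 K)ˣ, (ε : 𝓞 K) ^ 2 = 1) (s : ℂ) {u : ℂ × ℝ}
    (hu : 0 < u.2) (q : Quotient (QuotientGroup.rightRel (stabInfty K))) :
    classicalTerm σ (unipInfty K) s u (liftClass K (Sum.inl q)) =
      classicalTerm σ (stabInfty K) s u q :=
  apply_out_rightRel (f := fun γ => pullback (slMatrix σ γ) (vsdz s) u)
    (fun _ hβ γ => pullback_slMatrix_mul hO s hu (unipInfty_le_stabInfty hβ) γ) q.out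

theorem classicalTerm_inr (hO : ∀ ε : (𝓞 K)ˣ, (ε : 𝓞 K) ^ 2 = 1) (s : ℂ) {u : ℂ × ℝ}
    (hu : 0 < u.2) (q : Quotient (QuotientGroup.rightRel (stabInfty K))) :
    classicalTerm σ (unipInfty K) s u (liftClass K (Sum.inr q)) =
      classicalTerm σ (stabInfty K) s u q := by
  have h1 := apply_out_rightRel (f := fun γ => pullback (slMatrix σ γ) (vsdz s) u)
    (fun _ hβ γ => pullback_slMatrix_mul hO s hu (unipInfty_le_stabInfty hβ) γ) (-q.out)
  have h2 := pullback_slMatrix_mul (σ := σ) hO s hu (neg_mul_inv_mem_stabInfty q.out) q.out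
  rw [inv_mul_cancel_right] at h2
  exact h1.trans h2

/-- One of the two lifts embeds this series as a subseries of the one over `N_∞ \ Γ`. -/
theorem summable_classicalTerm_stabInfty [NumberField.IsTotallyComplex K]
    (hdeg : Module.finrank ℚ K = 2) (hO : ∀ ε : (𝓞 K)ˣ, (ε : 𝓞 K) ^ 2 = 1) {s : ℂ}
    (hs : 1 < s.re) {u : ℂ × ℝ} (hu : 0 < u.2) :
    Summable (classicalTerm σ (stabInfty K) s u) := by
  have h := (summable_classicalTerm_unipInfty σ hdeg hs hu).comp_injective
    (liftClass_injective.comp Sum.inl_injective)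
  have e : classicalTerm σ (unipInfty K) s u ∘ liftClass K ∘ Sum.inl =
      classicalTerm σ (stabInfty K) s u := funext (classicalTerm_inl hO s hu)
  rwa [e] at h

theorem classicalEis_unipInfty [NumberField.IsTotallyComplex K]
    (hdeg : Module.finrank ℚ K = 2) (hO : ∀ ε : (𝓞 K)ˣ, (ε : 𝓞 K) ^ 2 = 1) {s : ℂ}
    (hs : 1 < s.re) {u : ℂ × ℝ} (hu : 0 < u.2) :
    classicalEis σ (unipInfty K) s u =
      classicalEis σ (stabInfty K) s u + classicalEis σ (stabInfty K) s u := by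
  have h := (summable_classicalTerm_stabInfty (σ := σ) hdeg hO hs hu).hasSum
  let e := Equiv.ofBijective (liftClass K) ⟨liftClass_injective, liftClass_surjective hO⟩
  have h2 : HasSum (classicalTerm σ (unipInfty K) s u ∘ e)
      (classicalEis σ (stabInfty K) s u + classicalEis σ (stabInfty K) s u) := by
    refine HasSum.sum ?_ ?_
    · exact h.congr_fun fun q => classicalTerm_inl hO s hu q
    · exact h.congr_fun fun q => classicalTerm_inr hO s hu q
  exact (e.hasSum_iff.1 h2).tsum_eq

/-! ## The comparison -/

variable (K) in
/-- The inclusion of `SL₂(𝓞)` in `GL₂(K)`. -/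
def integralToGL : Matrix.SpecialLinearGroup (Fin 2) (𝓞 K) →* GL (Fin 2) K :=
  Matrix.SpecialLinearGroup.toGL.comp (Matrix.SpecialLinearGroup.map (algebraMap (𝓞 K) K))

theorem integralToGL_apply (γ : Matrix.SpecialLinearGroup (Fin 2) (𝓞 K)) (i j : Fin 2) :
    integralToGL K γ i j = (γ i j : K) := rfl

theorem integralToGL_mem_borel {γ : Matrix.SpecialLinearGroup (Fin 2) (𝓞 K)} :
    integralToGL K γ ∈ borel K ↔ γ ∈ stabInfty K := by
  change integralToGL K γ 1 0 = 0 ↔ γ 1 0 = 0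
  rw [integralToGL_apply]
  simp

theorem rational_integralToGL_snd_det (γ : Matrix.SpecialLinearGroup (Fin 2) (𝓞 K)) :
    (rational σ (integralToGL K γ)).2.det = 1 := by
  have h := γ.det_coe
  rw [Matrix.det_fin_two] at h
  have h' := congrArg (fun x : 𝓞 K => algebraMap K (Af K) (x : K)) h
  simp only [map_sub, map_mul, map_one] at h'
  refine Units.ext ?_
  rw [Matrix.GeneralLinearGroup.val_det_apply, Matrix.det_fin_two]
  exact h'

theorem rational_integralToGL_snd_mem (γ : Matrix.SpecialLinearGroup (Fin 2) (𝓞 K)) :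
    (rational σ (integralToGL K γ)).2 ∈ maxCompact K := by
  refine mem_maxCompact_of_norm (fun i j v => ?_) (fun v => ?_)
  · exact NumberField.FinitePlace.norm_le_one K v (γ i j)
  · have h := congrArg Units.val (rational_integralToGL_snd_det (σ := σ) γ)
    rw [Matrix.GeneralLinearGroup.val_det_apply, Units.val_one] at h
    rw [h, Af_one_apply, norm_one]

/-- Class number one: `GL₂(K) = B(K) SL₂(𝓞)`. -/
theorem exists_mul_inv_mem_borel (hcl : NumberField.classNumber K = 1) (δ : GL (Fin 2) K) :
    ∃ γ : Matrix.SpecialLinearGroup (Fin 2) (𝓞 K), δ * (integralToGL K γ)⁻¹ ∈ borel K := by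
  have hpir : IsPrincipalIdealRing (𝓞 K) := NumberField.classNumber_eq_one_iff.1 hcl
  -- Only the bottom row of `δ` matters modulo `B(K)`: clear its denominators, then divide by a
  -- greatest common divisor to make it primitive.
  obtain ⟨m, hm⟩ := IsLocalization.exist_integer_multiples_of_finite (nonZeroDivisors (𝓞 K))
    (fun j : Fin 2 => δ 1 j)
  obtain ⟨c, hc⟩ := hm 0
  obtain ⟨d, hd⟩ := hm 1
  have hm0 : ((m : 𝓞 K) : K) ≠ 0 := by
    simp
  have hc' : algebraMap (𝓞 K) K c = (m : 𝓞 K) * δ 1 0 := by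
    rw [← Algebra.smul_def]; exact hc
  have hd' : algebraMap (𝓞 K) K d = (m : 𝓞 K) * δ 1 1 := by
    rw [← Algebra.smul_def]; exact hd
  have hne : ¬(c = 0 ∧ d = 0) := by
    rintro ⟨rfl, rfl⟩
    rw [map_zero, eq_comm, mul_eq_zero, or_iff_right hm0] at hc' hd'
    have := δ.det.ne_zero
    rw [Matrix.GeneralLinearGroup.val_det_apply, Matrix.det_fin_two, hc', hd'] at this
    simp at this
  classical
  let _ : GCDMonoid (𝓞 K) := IsBezout.toGCDDomain _
  obtain ⟨c₀, d₀, t, ht, hcop, rfl, rfl⟩ : ∃ c₀ d₀ t : 𝓞 K, t ≠ 0 ∧ IsCoprime c₀ d₀ ∧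
      c = t * c₀ ∧ d = t * d₀ := by
    obtain ⟨c₀, d₀, h1, h2, hu⟩ := extract_gcd c d
    refine ⟨c₀, d₀, gcd c d, fun h => hne ((gcd_eq_zero_iff _ _).1 h), ?_, h1, h2⟩
    exact (gcd_isUnit_iff _ _).1 hu
  obtain ⟨x, y, hxy⟩ := hcop
  -- Bézout coefficients complete the primitive row to determinant one. The bottom row of `δ` is
  -- proportional to `(c₀, d₀)`, so the lower left entry of `δ γ⁻¹` vanishes.
  let γ : Matrix.SpecialLinearGroup (Fin 2) (𝓞 K) := ⟨!![y, -x; c₀, d₀], by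
    rw [Matrix.det_fin_two_of]
    linear_combination hxy⟩
  refine ⟨γ, ?_⟩
  rw [← map_inv]
  change (δ * integralToGL K γ⁻¹) 1 0 = 0
  have hinv : ∀ i j, integralToGL K γ⁻¹ i j = algebraMap (𝓞 K) K (!![d₀, x; -c₀, y] i j) := by
    intro i j
    rw [integralToGL_apply, Matrix.SpecialLinearGroup.coe_inv]
    change algebraMap (𝓞 K) K (!![y, -x; c₀, d₀].adjugate i j) = _
    rw [Matrix.adjugate_fin_two_of, neg_neg]
  rw [Units.val_mul, Matrix.mul_apply, Fin.sum_univ_two, hinv, hinv]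
  simp only [Matrix.of_apply, Matrix.cons_val', Matrix.cons_val_zero, Matrix.cons_val_one,
    Matrix.cons_val_fin_one, map_neg]
  apply mul_left_cancel₀ hm0
  rw [mul_zero, mul_add, ← mul_assoc, ← mul_assoc, ← hc', ← hd', map_mul, map_mul]
  ring

/-- The bijection `Γ_∞ \ Γ → B(ℚ) \ G(ℚ)`, `γ ↦ γ δ`. -/
theorem bijective_coset (hcl : NumberField.classNumber K = 1) (δ : GL (Fin 2) K) :
    Function.Bijective fun q : Quotient (QuotientGroup.rightRel (stabInfty K)) =>
      Quotient.mk (QuotientGroup.rightRel (borel K)) (integralToGL K q.out * δ) := by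
  constructor
  · intro q q' h
    have h := QuotientGroup.rightRel_apply.1 (Quotient.exact h)
    rw [mul_inv_rev, mul_assoc, mul_inv_cancel_left, ← map_inv, ← map_mul,
      integralToGL_mem_borel] at h
    rw [← Quotient.out_equiv_out]
    exact QuotientGroup.rightRel_apply.2 h
  · intro p
    induction p using Quotient.inductionOn with | _ γ
    obtain ⟨γ₀, h⟩ := exists_mul_inv_mem_borel hcl (γ * δ⁻¹)
    refine ⟨Quotient.mk _ γ₀, Quotient.sound (QuotientGroup.rightRel_apply.2 ?_)⟩
    have h2 := QuotientGroup.rightRel_apply.1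
      (Quotient.mk_out (s := QuotientGroup.rightRel (stabInfty K)) γ₀)
    rw [← integralToGL_mem_borel, map_mul, map_inv] at h2
    have h3 := mul_mem h h2
    rwa [mul_assoc, inv_mul_cancel_left, mul_assoc, ← mul_inv_rev] at h3

variable [NumberField.IsTotallyComplex K] {φ₁ φ₂ : HeckeCharacter σ}

theorem hasSum_adelicTerm (hdeg : Module.finrank ℚ K = 2) (hcl : NumberField.classNumber K = 1)
    (hO : ∀ ε : (𝓞 K)ˣ, (ε : 𝓞 K) ^ 2 = 1)
    (h₁ : ∀ z : ℂˣ, φ₁.infPart z = (z : ℂ)) (h₂ : ∀ z : ℂˣ, φ₂.infPart z = (z : ℂ)⁻¹) {s : ℂ}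
    (hs : 1 < s.re) {Ψ : GL (Fin 2) (Af K) → ℂ} (hΨ : Ψ ∈ inducedSpace φ₁ φ₂ s) {u : ℂ × ℝ}
    (hu : 0 < u.2) {g : GL (Fin 2) ℂ} (hg : act (g : Matrix (Fin 2) (Fin 2) ℂ) basePt = u)
    (ξ : ℂ × ℝ) (γ : GL (Fin 2) K) {k : GL (Fin 2) (Af K)} (hk : k ∈ maxCompact K) :
    HasSum (adelicTerm σ (omegaTilde Ψ s) (toLie g u ξ) (rational σ γ * (g, k)))
      (1 / 2 * Ψ k * classicalEis σ (stabInfty K) s u ξ) := by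
  -- Reindexing by `γ' ↦ γ' γ⁻¹` with `γ' ∈ Γ_∞ \ Γ` absorbs the rational translate `γ`, so each
  -- summand is evaluated at `γ' (g, k)`.
  let e := Equiv.ofBijective _ (bijective_coset hcl γ⁻¹)
  rw [← e.hasSum_iff]
  have hsum := ((ContinuousLinearMap.apply ℝ ℂ ξ).hasSum
    (summable_classicalTerm_stabInfty (σ := σ) hdeg hO hs hu).hasSum).mul_left (1 / 2 * Ψ k)
  refine hsum.congr_fun fun q => ?_
  obtain ⟨X, hX, -⟩ := toLie_eq g u ξ
  have hinv := apply_out_rightRel (H := borel K)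
    (f := fun δ => omegaTilde Ψ s (toLie g u ξ) (rational σ δ * (rational σ γ * (g, k))))
    (fun β hβ δ => by
      rw [map_mul, mul_assoc, hX]
      exact omegaTilde_rational_mul hdeg h₁ h₂ hΨ X.2 hβ _) (integralToGL K q.out * γ⁻¹)
  refine hinv.trans ?_
  rw [← mul_assoc, ← map_mul, inv_mul_cancel_right]
  have h := omegaTilde_eq_pullback Ψ s g (rational σ (integralToGL K q.out)).1 hu hg ξ
    ((rational σ (integralToGL K q.out)).2 * k)
  -- The finite component of `γ' ∈ SL₂(𝓞)` drops out of `Ψ`, leaving the constant `Ψ k`.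
  rw [apply_mul_of_det_eq_one hΨ (rational_integralToGL_snd_mem _)
    (rational_integralToGL_snd_det _) hk] at h
  exact h

end Comparison

end Bianchi

end

/-! ### The proposition and its analytic continuation -/

open Bianchi in
theorem proposition4p3 {K : Type*} [Field K] [NumberField K] [NumberField.IsTotallyComplex K]
    (hdeg : Module.finrank ℚ K = 2) (hcl : NumberField.classNumber K = 1) (σ : K →+* ℂ)
    (χ φ₁ φ₂ : HeckeCharacter σ)
    (hχ : χ.toHom = φ₁.toHom / φ₂.toHom)
    (hunr : χ.IsUnramified) (hχinf : ∀ z : ℂˣ, χ.infPart z = (z : ℂ) ^ 2)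
    (h₁ : ∀ z : ℂˣ, φ₁.infPart z = (z : ℂ)) (h₂ : ∀ z : ℂˣ, φ₂.infPart z = (z : ℂ)⁻¹) :
    -- the summands of the classical series only depend on the class of `γ`
    (∀ s : ℂ, ∀ γ ∈ stabInfty K, ∀ u : ℂ × ℝ, 0 < u.2 →
      pullback (slMatrix σ γ) (vsdz s) u = vsdz s u) ∧
    (∀ (s : ℂ), ∀ Ψ ∈ inducedSpace φ₁ φ₂ s,
      -- the left and right equivariance of `ω̃_{Ψ,s}`
      (∀ X ∈ 𝔭, ∀ γ ∈ borel K, ∀ g : GA K,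
        omegaTilde Ψ s X (rational σ γ * g) = omegaTilde Ψ s X g) ∧
      (∀ X ∈ 𝔭, ∀ k ∈ Kinf, ∀ k' ∈ level φ₁, ∀ g : GA K,
        omegaTilde Ψ s X (g * (k, k')) = omegaTilde Ψ s (Ad k X) g) ∧
      -- the comparison in the domain of convergence, at all points `γ (g, k)` of `G(𝔸)`;
      -- `γ = 1`, `k = 1` gives the comparison of the 1-forms on hyperbolic 3-space
      (1 < s.re → ∀ u : ℂ × ℝ, 0 < u.2 →
        Summable (classicalTerm σ (stabInfty K) s u) ∧
        Summable (classicalTerm σ (unipInfty K) s u) ∧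
        ∀ g : GL (Fin 2) ℂ, act (g : Matrix (Fin 2) (Fin 2) ℂ) basePt = u → ∀ ξ : ℂ × ℝ,
        ∀ γ : GL (Fin 2) K, ∀ k ∈ maxCompact K,
          Summable (adelicTerm σ (omegaTilde Ψ s) (toLie g u ξ) (rational σ γ * (g, k))) ∧
          adelicEis σ (omegaTilde Ψ s) (toLie g u ξ) (rational σ γ * (g, k)) =
            1 / 2 * Ψ k * classicalEis σ (stabInfty K) s u ξ ∧
          adelicEis σ (omegaTilde Ψ s) (toLie g u ξ) (rational σ γ * (g, k)) =
            1 / 4 * Ψ k * classicalEis σ (unipInfty K) s u ξ)) ∧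
    -- the comparison of the analytic continuations, along flat sections
    (∀ Ψ ∈ inducedSpace φ₁ φ₂ 0,
      (∀ s : ℂ, flatSection Ψ s ∈ inducedSpace φ₁ φ₂ s ∧
        ∀ k ∈ maxCompact K, flatSection Ψ s k = Ψ k) ∧
      ∀ U : Set ℂ, IsOpen U → IsPreconnected U → (∃ s ∈ U, 1 < s.re) →
      ∀ u : ℂ × ℝ, 0 < u.2 → ∀ g : GL (Fin 2) ℂ,
        act (g : Matrix (Fin 2) (Fin 2) ℂ) basePt = u → ∀ ξ : ℂ × ℝ,
      ∀ γ : GL (Fin 2) K, ∀ k ∈ maxCompact K,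
      ∀ F H : ℂ → ℂ, AnalyticOnNhd ℂ F U → AnalyticOnNhd ℂ H U →
        (∀ s ∈ U, 1 < s.re →
          F s = adelicEis σ (omegaTilde (flatSection Ψ s) s) (toLie g u ξ)
            (rational σ γ * (g, k))) →
        (∀ s ∈ U, 1 < s.re → H s = classicalEis σ (stabInfty K) s u ξ) →
        ∀ s ∈ U, F s = 1 / 2 * Ψ k * H s) := by
  have hO := sq_eq_one_of_isUnramified hunr hχinf
  refine ⟨fun s γ hγ u hu => pullback_stabInfty hO s hγ hu, fun s Ψ hΨ => ⟨?_, ?_, ?_⟩,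
    fun Ψ hΨ => ⟨?_, ?_⟩⟩
  · exact fun X hX γ hγ g => omegaTilde_rational_mul hdeg h₁ h₂ hΨ hX hγ g
  · exact fun X _ k hk k' hk' g => omegaTilde_mul_right hΨ X hk hk' g
  · intro hs u hu
    refine ⟨summable_classicalTerm_stabInfty hdeg hO hs hu,
      summable_classicalTerm_unipInfty σ hdeg hs hu, fun g hg ξ γ k hk => ?_⟩
    have h := hasSum_adelicTerm hdeg hcl hO h₁ h₂ hs hΨ hu hg ξ γ hk
    refine ⟨h.summable, h.tsum_eq, h.tsum_eq.trans ?_⟩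
    rw [classicalEis_unipInfty hdeg hO hs hu, add_apply]
    ring
  · exact fun s => ⟨flatSection_mem hΨ s, fun k hk => flatSection_apply_of_mem_maxCompact Ψ s hk⟩
  · rintro U hU hconn ⟨s₀, hs₀U, hs₀⟩ u hu g hg ξ γ k hk F H hF hH hFE hHE
    -- Identity theorem: both sides are analytic on the connected `U` and agree near `s₀`, because
    -- `Re s > 1` is an open condition.
    refine hF.eqOn_of_preconnected_of_eventuallyEq (analyticOnNhd_const.mul hH) hconn hs₀U ?_
    have hre : ∀ᶠ s : ℂ in nhds s₀, 1 < s.re :=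
      Complex.continuous_re.continuousAt.eventually (lt_mem_nhds hs₀)
    filter_upwards [hU.mem_nhds hs₀U, hre] with s hsU hs
    -- The constant is independent of `s` since the flat section keeps its values on `GL₂(𝓞̂)`;
    -- rewriting `Ψ k` this way lets the comparison in `V_{φ_s}` apply.
    rw [hFE s hsU hs, hHE s hsU hs,
      ← flatSection_apply_of_mem_maxCompact Ψ s hk]
    exact (hasSum_adelicTerm hdeg hcl hO h₁ h₂ hs (flatSection_mem hΨ s) hu hg ξ γ hk).tsum_eq
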